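/- Let $\mathcal G$ be a finite metric graph with finite vertex set $V$, finite set $\mathcal I$ of internal edges $i$, identified with intervals $I_i=[0,a_i]$ with $a_i>0$, and finite set $\mathcal E$ of external edges $e$, identified with half-lines $I_e=[0,\infty)$. Let $\mathcal H=\bigoplus_{j\in\mathcal E\cup\mathcal I}L^2(I_j)$ and let $\mathcal D$ be the set of all $\psi=(\psi_j)_j\in\mathcal H$ such that $\psi_j$ and $\psi_j'$ are absolutely continuous and $\psi_j''\in L^2(I_j)$ for every edge $j$. Let $\mathcal K=\mathbb C^{|\mathcal E|}\oplus\mathbb C^{|\mathcal I|}\oplus\mathbb C^{|\mathcal I|}$, and for $\psi\in\mathcal D$ put $$\underline{\psi}=\big(\{\psi_e(0)\}_{e\in\mathcal E},\{\psi_i(0)\}_{i\in\mathcal I},\{\psi_i(a_i)\}_{i\in\mathcal I}\big),\qquad \underline{\psi}'=\big(\{\psi_e'(0)\}_{e\in\mathcal E},\{\psi_i'(0)\}_{i\in\mathcal I},\{-\psi_i'(a_i)\}_{i\in\mathcal I}\big).$$ For linear maps $A,B$ in $\mathcal K$ let $-\Delta(A,B)$ be the operator in $\mathcal H$ acting by $\psi\mapsto(-\psi_j'')_j$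 with domain $\{\psi\in\mathcal D : A\underline{\psi}+B\underline{\psi}'=0\}$. An operator $T$ in $\mathcal H$ is called quasi-accretive if there is $C\in\mathbb R$ with $\operatorname{Re}\langle u,Tu\rangle+C\langle u,u\rangle\ge 0$ for all $u\in\operatorname{Dom}(T)$; quasi-m-accretive if it is closed, quasi-accretive and has no proper quasi-accretive extension; sectorial if there is $C\in\mathbb R$ with $|\operatorname{Im}\langle u,Tu\rangle|\le\operatorname{Re}\langle u,Tu\rangle+C\langle u,u\rangle$ for all $u\in\operatorname{Dom}(T)$; and m-sectorial if it is sectorial and quasi-m-accretive. Theorem 1. Let $A,B$ be linear maps in $\mathcal K$. Let $Q$ be the orthogonal projector in $\mathcal K$ onto $(\operatorname{Ran}B)^\perp$, $P$ the orthogonal projector in $\mathcal K$ onto $\operatorname{Ker}B$, and $P^\perp=1-P$. (1) The operator $-\Delta(A,B)$ is quasi-m-accretive if and only if the map $(A,B)\colon\mathcal K\oplus\mathcal K\to\mathcal K$, $\chi_1\oplus\chi_2\mapsto A\chi_1+B\chi_2$, is surjective and $QAP^\perp=0$. (2) If $-\Delta(A,B)$ is quasi-m-accretive, then it is m-sectorial.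 -/

import Mathlib

open MeasureTheory

/-! ### Accretive and sectorial operators in a Hilbert space -/

section Operators

variable {H : Type*} [NormedAddCommGroup H] [InnerProductSpace ℂ H]

/-- `T` is quasi-accretive: `Re ⟨u, T u⟩ + C ⟨u, u⟩ ≥ 0` on `Dom T`, for some real constant `C`. -/
def IsQuasiAccretive (T : H →ₗ.[ℂ] H) : Prop :=
  ∃ C : ℝ, ∀ u : T.domain, 0 ≤ (inner ℂ (u : H) (T u)).re + C * ‖(u : H)‖ ^ 2

/-- `T` is quasi-m-accretive: it is a closed quasi-accretive operator which has no proper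
quasi-accretive extension. -/
def IsQuasiMAccretive (T : H →ₗ.[ℂ] H) : Prop :=
  T.IsClosed ∧ IsQuasiAccretive T ∧
    ∀ S : H →ₗ.[ℂ] H, T ≤ S → IsQuasiAccretive S → S = T

/-- `T` is sectorial: `|Im ⟨u, T u⟩| ≤ Re ⟨u, T u⟩ + C ⟨u, u⟩` on `Dom T`, for some real
constant `C`. -/
def IsSectorialOp (T : H →ₗ.[ℂ] H) : Prop :=
  ∃ C : ℝ, ∀ u : T.domain,
    |(inner ℂ (u : H) (T u)).im| ≤ (inner ℂ (u : H) (T u)).re + C * ‖(u : H)‖ ^ 2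

/-- `T` is m-sectorial: it is sectorial and quasi-m-accretive. -/
def IsMSectorial (T : H →ₗ.[ℂ] H) : Prop :=
  IsSectorialOp T ∧ IsQuasiMAccretive T

end Operators

/-! ### Metric graphs -/

/-- A metric graph with vertex set `V`, internal edges `I` and external edges `E`: the boundary
map sends an internal edge to its (initial, terminal) vertices and an external edge to its
initial vertex, and each internal edge has a positive length. -/
structure MetricGraph (V I E : Type*) where
  bdInt : I → V × V
  bdExt : E → V
  len : I → ℝ
  len_pos : ∀ i, 0 < len i

namespace MetricGraph

variable {V I E : Type*} (G : MetricGraph V I E)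

/-- The interval of an edge: `[0, ∞)` for an external edge, `[0, aᵢ]` for an internal one. -/
def interval : E ⊕ I → Set ℝ
  | Sum.inl _ => Set.Ici 0
  | Sum.inr i => Set.Icc 0 (G.len i)

/-- The space `L²` of an edge. -/
abbrev EdgeSpace (j : E ⊕ I) : Type :=
  Lp ℂ 2 (volume.restrict (G.interval j))

/-- The Hilbert space of the graph, the orthogonal direct sum of the spaces `L²` of its edges. -/
abbrev HilbertSpace [Fintype I] [Fintype E] : Type _ :=
  PiLp 2 (fun j : E ⊕ I => G.EdgeSpace j)

/-- `f` is (locally) absolutely continuous on `s`: absolutely continuous on each compact interval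
with end points in `s`. -/
def LocAC (f : ℝ → ℂ) (s : Set ℝ) : Prop :=
  ∀ a ∈ s, ∀ b ∈ s, AbsolutelyContinuousOnInterval f a b

/-- `ψ ∈ L²(s)` has the representative `f`, with first derivative `g` and second derivative
`χ ∈ L²(s)`: `f` and `g = f'` are absolutely continuous on `s`, and `g' = χ` almost everywhere.
At the end points of `s` derivatives are one-sided. -/
structure IsRep {s : Set ℝ} (ψ χ : Lp ℂ 2 (volume.restrict s)) (f g : ℝ → ℂ) : Prop where
  ae_eq : (ψ : ℝ → ℂ) =ᵐ[volume.restrict s] f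
  ac : LocAC f s
  deriv : ∀ x ∈ s, HasDerivWithinAt f (g x) s x
  ac_deriv : LocAC g s
  deriv_two : ∀ᵐ x ∂(volume.restrict s), HasDerivWithinAt g (χ x) s x

variable {G}

theorem convex_interval (j : E ⊕ I) : Convex ℝ (G.interval j) := by
  cases j with
  | inl e => exact convex_Ici 0
  | inr i => exact convex_Icc 0 _

theorem interior_interval_nonempty (j : E ⊕ I) : (interior (G.interval j)).Nonempty := by
  cases j with
  | inl e => simp [interval]
  | inr i => simpa [interval] using G.len_pos i

theorem uniqueDiffOn_interval (j : E ⊕ I) : UniqueDiffOn ℝ (G.interval j) :=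
  uniqueDiffOn_convex (convex_interval j) (interior_interval_nonempty j)

theorem measurableSet_interval (j : E ⊕ I) : MeasurableSet (G.interval j) := by
  cases j with
  | inl e => exact measurableSet_Ici
  | inr i => exact measurableSet_Icc

theorem zero_mem_interval (j : E ⊕ I) : (0 : ℝ) ∈ G.interval j := by
  cases j with
  | inl e => exact Set.self_mem_Ici
  | inr i => exact Set.left_mem_Icc.2 (G.len_pos i).le

theorem len_mem_interval (i : I) : G.len i ∈ G.interval (Sum.inr i : E ⊕ I) :=
  Set.right_mem_Icc.2 (G.len_pos i).le

theorem IsRep.add {s : Set ℝ} {ψ χ ψ' χ' : Lp ℂ 2 (volume.restrict s)} {f g f' g' : ℝ → ℂ}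
    (h : IsRep ψ χ f g) (h' : IsRep ψ' χ' f' g') :
    IsRep (ψ + ψ') (χ + χ') (f + f') (g + g') where
  ae_eq := (Lp.coeFn_add ψ ψ').trans (h.ae_eq.add h'.ae_eq)
  ac a ha b hb := (h.ac a ha b hb).add (h'.ac a ha b hb)
  deriv x hx := (h.deriv x hx).add (h'.deriv x hx)
  ac_deriv a ha b hb := (h.ac_deriv a ha b hb).add (h'.ac_deriv a ha b hb)
  deriv_two := by
    filter_upwards [h.deriv_two, h'.deriv_two, Lp.coeFn_add χ χ'] with x h1 h2 h3
    rw [h3]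
    exact h1.add h2

theorem IsRep.smul {s : Set ℝ} {ψ χ : Lp ℂ 2 (volume.restrict s)} {f g : ℝ → ℂ}
    (c : ℂ) (h : IsRep ψ χ f g) : IsRep (c • ψ) (c • χ) (c • f) (c • g) where
  ae_eq := (Lp.coeFn_smul c ψ).trans (h.ae_eq.const_smul c)
  ac a ha b hb := (h.ac a ha b hb).const_smul c
  deriv x hx := (h.deriv x hx).const_smul c
  ac_deriv a ha b hb := (h.ac_deriv a ha b hb).const_smul c
  deriv_two := by
    filter_upwards [h.deriv_two, Lp.coeFn_smul c χ] with x h1 h3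
    rw [h3]
    exact h1.const_smul c

theorem IsRep.zero {s : Set ℝ} : IsRep (0 : Lp ℂ 2 (volume.restrict s)) 0 0 0 where
  ae_eq := Lp.coeFn_zero _ _ _
  ac a _ b _ := (LipschitzWith.const (0 : ℂ)).lipschitzOnWith.absolutelyContinuousOnInterval
  deriv x _ := hasDerivWithinAt_const x s (0 : ℂ)
  ac_deriv a _ b _ :=
    (LipschitzWith.const (0 : ℂ)).lipschitzOnWith.absolutelyContinuousOnInterval
  deriv_two := by
    filter_upwards [Lp.coeFn_zero ℂ 2 (volume.restrict s)] with x h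
    rw [h]
    exact hasDerivWithinAt_const x s (0 : ℂ)

/-- The continuous representative is unique on the edge. -/
theorem IsRep.eqOn {j : E ⊕ I} {ψ χ χ' : G.EdgeSpace j} {f g f' g' : ℝ → ℂ}
    (h : IsRep ψ χ f g) (h' : IsRep ψ χ' f' g') : Set.EqOn f f' (G.interval j) :=
  Measure.eqOn_of_ae_eq (h.ae_eq.symm.trans h'.ae_eq)
    (fun x hx => (h.deriv x hx).continuousWithinAt)
    (fun x hx => (h'.deriv x hx).continuousWithinAt) (by
      rw [(convex_interval j).closure_interior_eq_closure_of_nonempty_interior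
        (interior_interval_nonempty j)]
      exact subset_closure)

/-- The derivative of the continuous representative is unique on the edge. -/
theorem IsRep.eqOn_deriv {j : E ⊕ I} {ψ χ χ' : G.EdgeSpace j} {f g f' g' : ℝ → ℂ}
    (h : IsRep ψ χ f g) (h' : IsRep ψ χ' f' g') : Set.EqOn g g' (G.interval j) := by
  intro x hx
  have h1 := (h'.deriv x hx).congr (h.eqOn h') (h.eqOn h' hx)
  exact (uniqueDiffOn_interval j x hx).eq_deriv _ (h.deriv x hx) h1

/-- The second derivative is unique. -/
theorem IsRep.eq_deriv_two {j : E ⊕ I} {ψ χ χ' : G.EdgeSpace j} {f g f' g' : ℝ → ℂ}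
    (h : IsRep ψ χ f g) (h' : IsRep ψ χ' f' g') : χ = χ' := by
  refine Lp.ext ?_
  filter_upwards [h.deriv_two, h'.deriv_two,
    ae_restrict_mem (measurableSet_interval j)] with x h1 h2 hx
  have h3 := h2.congr (h.eqOn_deriv h') (h.eqOn_deriv h' hx)
  exact (uniqueDiffOn_interval j x hx).eq_deriv _ h1 h3

variable (G)

/-- The maximal domain of the second derivative on the edge `j`: all `ψ ∈ L²` such that `ψ` and
`ψ'` are absolutely continuous and `ψ''` is square integrable. -/
def edgeDomain (j : E ⊕ I) : Submodule ℂ (G.EdgeSpace j) where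
  carrier := {ψ | ∃ (χ : G.EdgeSpace j) (f g : ℝ → ℂ), IsRep ψ χ f g}
  zero_mem' := ⟨0, 0, 0, IsRep.zero⟩
  add_mem' := by
    rintro _ _ ⟨χ, f, g, h⟩ ⟨χ', f', g', h'⟩
    exact ⟨_, _, _, h.add h'⟩
  smul_mem' := by
    rintro c _ ⟨χ, f, g, h⟩
    exact ⟨_, _, _, h.smul c⟩

variable {G}

/-- The second derivative `ψ''` of a function in the maximal domain of an edge. -/
noncomputable def secondDeriv {j : E ⊕ I} (ψ : G.edgeDomain j) : G.EdgeSpace j :=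
  ψ.2.choose

/-- The continuous representative of a function in the maximal domain of an edge (only its values
on the edge are meaningful). -/
noncomputable def rep {j : E ⊕ I} (ψ : G.edgeDomain j) : ℝ → ℂ :=
  ψ.2.choose_spec.choose

/-- The derivative of the continuous representative (only its values on the edge are
meaningful). -/
noncomputable def repDeriv {j : E ⊕ I} (ψ : G.edgeDomain j) : ℝ → ℂ :=
  ψ.2.choose_spec.choose_spec.choose

theorem isRep {j : E ⊕ I} (ψ : G.edgeDomain j) :
    IsRep (ψ : G.EdgeSpace j) (secondDeriv ψ) (rep ψ) (repDeriv ψ) :=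
  ψ.2.choose_spec.choose_spec.choose_spec

/-- The second derivative as a linear map on the maximal domain of an edge. -/
noncomputable def secondDerivₗ (j : E ⊕ I) : G.edgeDomain j →ₗ[ℂ] G.EdgeSpace j where
  toFun := secondDeriv
  map_add' ψ φ := (isRep (ψ + φ)).eq_deriv_two ((isRep ψ).add (isRep φ))
  map_smul' c ψ := (isRep (c • ψ)).eq_deriv_two ((isRep ψ).smul c)

/-- The value `ψ(x)` at a point `x` of the edge, as a linear functional. -/
noncomputable def valueₗ (j : E ⊕ I) (x : ℝ) (hx : x ∈ G.interval j) :
    G.edgeDomain j →ₗ[ℂ] ℂ where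
  toFun ψ := rep ψ x
  map_add' ψ φ := (isRep (ψ + φ)).eqOn ((isRep ψ).add (isRep φ)) hx
  map_smul' c ψ := (isRep (c • ψ)).eqOn ((isRep ψ).smul c) hx

/-- The derivative `ψ'(x)` at a point `x` of the edge, as a linear functional. -/
noncomputable def derivₗ (j : E ⊕ I) (x : ℝ) (hx : x ∈ G.interval j) :
    G.edgeDomain j →ₗ[ℂ] ℂ where
  toFun ψ := repDeriv ψ x
  map_add' ψ φ := (isRep (ψ + φ)).eqOn_deriv ((isRep ψ).add (isRep φ)) hx
  map_smul' c ψ := (isRep (c • ψ)).eqOn_deriv ((isRep ψ).smul c) hx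

variable (G) [Fintype I] [Fintype E]

/-- The domain of the maximal Laplacian on the graph, the direct sum of the maximal domains of
the edges. -/
def maxDomain : Submodule ℂ G.HilbertSpace where
  carrier := {ψ | ∀ j, ψ j ∈ G.edgeDomain j}
  zero_mem' j := (G.edgeDomain j).zero_mem
  add_mem' h h' j := (G.edgeDomain j).add_mem (h j) (h' j)
  smul_mem' c _ h j := (G.edgeDomain j).smul_mem c (h j)

/-- The component on the edge `j` of an element of the maximal domain. -/
def component (j : E ⊕ I) : G.maxDomain →ₗ[ℂ] G.edgeDomain j where
  toFun ψ := ⟨(ψ : G.HilbertSpace) j, ψ.2 j⟩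
  map_add' _ _ := rfl
  map_smul' _ _ := rfl

/-- The maximal operator `-Δ`, `(-Δ ψ)ⱼ = -ψⱼ''`. -/
noncomputable def negLaplacianMax : G.HilbertSpace →ₗ.[ℂ] G.HilbertSpace where
  domain := G.maxDomain
  toFun := -((WithLp.linearEquiv 2 ℂ (∀ j, G.EdgeSpace j)).symm.toLinearMap ∘ₗ
    LinearMap.pi fun j => secondDerivₗ j ∘ₗ G.component j)

/-- The auxiliary space `𝒦 = 𝒦_E ⊕ 𝒦_I⁻ ⊕ 𝒦_I⁺` of vectors indexed by the ends of edges: the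
initial ends of the external edges, the initial ends and the terminal ends of the internal
edges. -/
abbrev BdSpace (I E : Type*) [Fintype I] [Fintype E] : Type _ :=
  EuclideanSpace ℂ (E ⊕ I ⊕ I)

/-- The vector of boundary values: `ψₑ(0)`, `ψᵢ(0)`, `ψᵢ(aᵢ)`. -/
noncomputable def bdValue : G.maxDomain →ₗ[ℂ] BdSpace I E :=
  (WithLp.linearEquiv 2 ℂ (E ⊕ I ⊕ I → ℂ)).symm.toLinearMap ∘ₗ
    LinearMap.pi fun k => match k with
      | Sum.inl e => valueₗ (Sum.inl e) 0 (zero_mem_interval _) ∘ₗ G.component (Sum.inl e)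
      | Sum.inr (Sum.inl i) =>
          valueₗ (Sum.inr i) 0 (zero_mem_interval _) ∘ₗ G.component (Sum.inr i)
      | Sum.inr (Sum.inr i) =>
          valueₗ (Sum.inr i) (G.len i) (len_mem_interval i) ∘ₗ G.component (Sum.inr i)

/-- The vector of inward derivatives at the boundary: `ψₑ'(0)`, `ψᵢ'(0)`, `-ψᵢ'(aᵢ)`. -/
noncomputable def bdDeriv : G.maxDomain →ₗ[ℂ] BdSpace I E :=
  (WithLp.linearEquiv 2 ℂ (E ⊕ I ⊕ I → ℂ)).symm.toLinearMap ∘ₗ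
    LinearMap.pi fun k => match k with
      | Sum.inl e => derivₗ (Sum.inl e) 0 (zero_mem_interval _) ∘ₗ G.component (Sum.inl e)
      | Sum.inr (Sum.inl i) =>
          derivₗ (Sum.inr i) 0 (zero_mem_interval _) ∘ₗ G.component (Sum.inr i)
      | Sum.inr (Sum.inr i) =>
          -(derivₗ (Sum.inr i) (G.len i) (len_mem_interval i) ∘ₗ G.component (Sum.inr i))

/-- The operator `-Δ(A, B)`: the restriction of the maximal operator `-Δ` to those `ψ` which
satisfy the boundary conditions `A ψ + B ψ' = 0`. -/
noncomputable def negLaplacian (A B : BdSpace I E →ₗ[ℂ] BdSpace I E) :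
    G.HilbertSpace →ₗ.[ℂ] G.HilbertSpace :=
  G.negLaplacianMax.domRestrict
    ((LinearMap.ker (A ∘ₗ G.bdValue + B ∘ₗ G.bdDeriv)).map G.maxDomain.subtype)

end MetricGraph

/-!
Let `u` be in the maximal domain, and let `x` and `y` be its vectors of boundary values and of
inward boundary derivatives. Integration by parts gives `⟨u, -Δ u⟩ = ‖u'‖ ^ 2 + ⟨x, y⟩`, and a trace
estimate bounds every multiple of `‖x‖ ^ 2` by `‖u'‖ ^ 2` up to a multiple of `‖u‖ ^ 2`. Both are
obtained together, without reference to `‖u'‖`, in `MetricGraph.exists_green`: on an edge one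
integrates the derivative of `conj u * (u' + φ u)` with an affine real function `φ`. On half-lines
the boundary terms at infinity vanish along a sequence (`MetricGraph.IsRep.exists_small`).

*Necessity.* Only quasi-accretivity is needed. There are functions with boundary value zero and an
arbitrary boundary derivative whose norm and energy are bounded by a constant
(`MetricGraph.exists_bdDeriv_eq`); they are concentrated near the ends of the edges. If
`A x + B y = 0` and `y₀ ∈ Ker B`, adding such a function for `y₀` to a fixed function with boundary
data `(x, y)` changes the quadratic form by `⟨x, y₀⟩` up to a constant. Hence `⟨x, y₀⟩ = 0`
(`MetricGraph.mem_ker_orthogonal_of_isQuasiAccretive`), so the relation `A x + B y = 0` lies in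
`(Ker B)^⊥ × 𝒦`. A count of dimensions turns this into surjectivity of `(A, B)` and `Q A P^⊥ = 0`
(`surjective_of_forall_mem_ker_orthogonal`).

*Sufficiency.* Conversely the algebraic conditions imply `x ⟂ Ker B` on the relation
(`mem_ker_orthogonal_of_surjective`). Then `⟨x, y⟩` depends only on the component of `y` orthogonal
to `Ker B`, which is a linear function of `x`. So `|⟨x, y⟩| ≤ c ‖x‖ ^ 2`, and by the trace estimate
`-Δ(A, B)` is sectorial, in particular quasi-accretive. It has no proper quasi-accretive extension,
and is closed, because `-Δ(A, B) + κ²` is surjective for large `κ`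
(`IsQuasiAccretive.isQuasiMAccretive`, `MetricGraph.exists_negLaplacian_add_smul_eq`): the
inhomogeneous equation is solved on each edge by convolution with `exp (-κ |x|) / (2 κ)`, and the
boundary conditions are met by adding a solution of the homogeneous equation.

As the necessity part shows that quasi-m-accretivity implies `x ⟂ Ker B`, it also implies that the
operator is sectorial.
-/

open Filter Topology Set

open scoped ENNReal

/-! ### Complex-valued absolutely continuous functions -/

theorem AbsolutelyContinuousOnInterval.congr_fun {f g : ℝ → ℂ} {a b : ℝ}
    (hf : AbsolutelyContinuousOnInterval f a b) (h : ∀ x, f x = g x) :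
    AbsolutelyContinuousOnInterval g a b := (funext h : f = g) ▸ hf

theorem AbsolutelyContinuousOnInterval.conj {f : ℝ → ℂ} {a b : ℝ}
    (hf : AbsolutelyContinuousOnInterval f a b) :
    AbsolutelyContinuousOnInterval (fun x => (starRingEnd ℂ) (f x)) a b := by
  have h : ∀ z w : ℂ, dist ((starRingEnd ℂ) z) ((starRingEnd ℂ) w) = dist z w :=
    fun z w => Complex.dist_conj_conj z w
  simpa only [AbsolutelyContinuousOnInterval, h] using hf

/-- The complex-valued case follows from the real-valued one in Mathlib, applied to the real and
imaginary parts. -/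
theorem absolutelyContinuousOnInterval_integral {f : ℝ → ℂ} {a b c : ℝ}
    (hf : IntervalIntegrable f volume a b) (hc : c ∈ uIcc a b) :
    AbsolutelyContinuousOnInterval (fun x => ∫ t in c..x, f t) a b := by
  have hre : IntervalIntegrable (fun t => (f t).re) volume a b := ⟨hf.1.re, hf.2.re⟩
  have him : IntervalIntegrable (fun t => (f t).im) volume a b := ⟨hf.1.im, hf.2.im⟩
  have h1 : AbsolutelyContinuousOnInterval (fun _ : ℝ => (1 : ℂ)) a b :=
    (LipschitzWith.const (1 : ℂ)).lipschitzOnWith.absolutelyContinuousOnInterval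
  have h2 : AbsolutelyContinuousOnInterval (fun _ : ℝ => Complex.I) a b :=
    (LipschitzWith.const Complex.I).lipschitzOnWith.absolutelyContinuousOnInterval
  have h := ((hre.absolutelyContinuousOnInterval_intervalIntegral hc).fun_smul h1).fun_add
    ((him.absolutelyContinuousOnInterval_intervalIntegral hc).fun_smul h2)
  have hEq : ∀ x ∈ uIcc a b, (∫ t in c..x, f t) =
      (∫ t in c..x, (f t).re) • (1 : ℂ) + (∫ t in c..x, (f t).im) • Complex.I := by
    intro x hx
    have hfx : IntervalIntegrable f volume c x := hf.mono_set (uIcc_subset_uIcc hc hx)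
    have e1 := (Complex.reCLM.intervalIntegral_comp_comm hfx)
    have e2 := (Complex.imCLM.intervalIntegral_comp_comm hfx)
    simp only [Complex.reCLM_apply, Complex.imCLM_apply] at e1 e2
    rw [e1, e2]
    simp [Complex.re_add_im]
  refine Tendsto.congr' ?_ h
  filter_upwards [mem_inf_of_right (mem_principal_self _)] with n hn
  refine Finset.sum_congr rfl fun i hi => ?_
  rw [hEq _ (hn.1 i hi).1, hEq _ (hn.1 i hi).2]

/-- The fundamental theorem of calculus for complex-valued absolutely continuous functions. -/
theorem AbsolutelyContinuousOnInterval.integral_eq_sub {F F' : ℝ → ℂ} {a b : ℝ}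
    (hF : AbsolutelyContinuousOnInterval F a b)
    (hd : ∀ᵐ x, x ∈ uIcc a b → HasDerivAt F (F' x) x)
    (hi : IntervalIntegrable F' volume a b) : ∫ x in a..b, F' x = F b - F a := by
  have h0 : ∀ᵐ x, x ∈ uIcc a b → HasDerivAt (fun x => F x - ∫ t in a..x, F' t) 0 x := by
    filter_upwards [hd, hi.ae_hasDerivAt_integral] with x h1 h2 hx
    simpa using (h1 hx).fun_sub (h2 hx a left_mem_uIcc)
  obtain ⟨C, hC⟩ := (hF.fun_sub
    (absolutelyContinuousOnInterval_integral hi left_mem_uIcc)).const_of_ae_hasDerivAt_zero h0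
  have h1 := hC a left_mem_uIcc
  have h2 := hC b right_mem_uIcc
  simp only [intervalIntegral.integral_same, sub_zero] at h1
  rw [← h1] at h2
  linear_combination -h2

namespace MetricGraph

/-! ### Integration by parts and trace estimates on an edge -/

/-- For `φ x = c - m * x`, `f' = g` and `g' = k` at `x`, the function `conj f * (g + φ * f)` has
derivative `conj f * k + ‖g + φ f‖ ^ 2 - (m + φ ^ 2) * ‖f‖ ^ 2`. The term `φ * f` completes the
square `‖g‖ ^ 2` in such a way that the boundary term `φ * ‖f‖ ^ 2` is controlled. -/
theorem hasDerivAt_conj_mul {f g : ℝ → ℂ} {k : ℂ} {c m x : ℝ} (hf : HasDerivAt f (g x) x)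
    (hg : HasDerivAt g k x) :
    HasDerivAt (fun x : ℝ => (starRingEnd ℂ) (f x) * (g x + ((c - m * x : ℝ) : ℂ) * f x))
      ((starRingEnd ℂ) (f x) * k +
        ((‖g x + ((c - m * x : ℝ) : ℂ) * f x‖ ^ 2 - (m + (c - m * x) ^ 2) * ‖f x‖ ^ 2 : ℝ) : ℂ))
      x := by
  have h1 : HasDerivAt (fun x : ℝ => (starRingEnd ℂ) (f x)) ((starRingEnd ℂ) (g x)) x := by
    simpa using hf.star
  have h2 : HasDerivAt (fun x : ℝ => ((c - m * x : ℝ) : ℂ)) ((-m : ℝ) : ℂ) x := by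
    have : HasDerivAt (fun x : ℝ => c - m * x) (-m) x := by
      simpa using ((hasDerivAt_id x).const_mul m).const_sub c
    exact this.ofReal_comp
  refine (h1.mul (hg.add (h2.mul hf))).congr_deriv ?_
  push_cast
  rw [← Complex.conj_mul', ← Complex.conj_mul']
  simp only [map_add, map_mul, map_sub, Complex.conj_ofReal]
  simp only [Pi.add_apply, Pi.mul_apply]
  ring

theorem IsRep.integrable_conj_mul {s : Set ℝ} {ψ χ : Lp ℂ 2 (volume.restrict s)} {f g : ℝ → ℂ}
    (h : IsRep ψ χ f g) : IntegrableOn (fun x => (starRingEnd ℂ) (f x) * χ x) s := by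
  refine (L2.integrable_inner (𝕜 := ℂ) ψ χ).congr ?_
  filter_upwards [h.ae_eq] with x hx
  rw [hx, RCLike.inner_apply, mul_comm]

theorem IsRep.inner_eq {s : Set ℝ} {ψ χ : Lp ℂ 2 (volume.restrict s)} {f g : ℝ → ℂ}
    (h : IsRep ψ χ f g) : inner ℂ ψ χ = ∫ x in s, (starRingEnd ℂ) (f x) * χ x := by
  rw [L2.inner_def]
  refine integral_congr_ae ?_
  filter_upwards [h.ae_eq] with x hx
  rw [hx, RCLike.inner_apply, mul_comm]

theorem integrableOn_norm_sq {s : Set ℝ} (ψ : Lp ℂ 2 (volume.restrict s)) :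
    IntegrableOn (fun x => ‖ψ x‖ ^ 2) s :=
  (Lp.memLp ψ).integrable_norm_pow (by norm_num)

theorem norm_sq_eq_integral {s : Set ℝ} (ψ : Lp ℂ 2 (volume.restrict s)) :
    ‖ψ‖ ^ 2 = ∫ x in s, ‖ψ x‖ ^ 2 := by
  apply Complex.ofReal_injective
  have h : (inner ℂ ψ ψ : ℂ) = ((‖ψ‖ ^ 2 : ℝ) : ℂ) := by
    rw [inner_self_eq_norm_sq_to_K]; push_cast; rfl
  rw [← h, L2.inner_def, ← integral_complex_ofReal]
  refine integral_congr_ae (Eventually.of_forall fun x => ?_)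
  beta_reduce
  rw [inner_self_eq_norm_sq_to_K]; push_cast; rfl

theorem IsRep.integrableOn_norm_sq {s : Set ℝ} {ψ χ : Lp ℂ 2 (volume.restrict s)} {f g : ℝ → ℂ}
    (h : IsRep ψ χ f g) : IntegrableOn (fun x => ‖f x‖ ^ 2) s := by
  refine (MetricGraph.integrableOn_norm_sq ψ).congr ?_
  filter_upwards [h.ae_eq] with x hx
  rw [hx]

theorem IsRep.norm_sq_eq {s : Set ℝ} {ψ χ : Lp ℂ 2 (volume.restrict s)} {f g : ℝ → ℂ}
    (h : IsRep ψ χ f g) : ‖ψ‖ ^ 2 = ∫ x in s, ‖f x‖ ^ 2 := by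
  rw [norm_sq_eq_integral]
  refine integral_congr_ae ?_
  filter_upwards [h.ae_eq] with x hx
  rw [hx]

theorem IsRep.ae_hasDerivAt {s : Set ℝ} {ψ χ : Lp ℂ 2 (volume.restrict s)} {f g : ℝ → ℂ}
    (h : IsRep ψ χ f g) {a b : ℝ} (hab : a ≤ b) (hs : Icc a b ⊆ s) :
    ∀ᵐ x, x ∈ uIcc a b → HasDerivAt f (g x) x ∧ HasDerivAt g (χ x) x := by
  have h1 : ∀ᵐ x ∂volume.restrict (Icc a b), HasDerivWithinAt g (χ x) s x :=
    ae_mono (Measure.restrict_mono hs le_rfl) h.deriv_two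
  rw [ae_restrict_iff' measurableSet_Icc] at h1
  have ha : ∀ᵐ x : ℝ, x ≠ a := by simp [ae_iff, measure_singleton]
  have hb : ∀ᵐ x : ℝ, x ≠ b := by simp [ae_iff, measure_singleton]
  filter_upwards [h1, ha, hb] with x h1 h2 h3 hx
  rw [uIcc_of_le hab] at hx
  have hn : s ∈ 𝓝 x := mem_of_superset
    (Icc_mem_nhds (lt_of_le_of_ne hx.1 (Ne.symm h2)) (lt_of_le_of_ne hx.2 h3)) hs
  exact ⟨(h.deriv x (hs hx)).hasDerivAt hn, (h1 hx).hasDerivAt hn⟩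

/-- Integration by parts and a trace estimate on `[0, R]`: the derivative of `conj f * (g + φ * f)`,
`φ x = c - m * x`, is integrated and the square `‖g + φ f‖ ^ 2` is dropped. The condition
`m * R ≤ 2 * c` means that `φ` is bounded by `c`. -/
theorem IsRep.green_Icc {s : Set ℝ} {ψ χ : Lp ℂ 2 (volume.restrict s)} {f g : ℝ → ℂ}
    (h : IsRep ψ χ f g) {R c m : ℝ} (hR : 0 ≤ R) (hs : Icc 0 R ⊆ s)
    (hm : 0 ≤ m) (hmR : m * R ≤ 2 * c) :
    ((∫ x in 0..R, (starRingEnd ℂ) (f x) * χ x) + (starRingEnd ℂ) (f 0) * g 0 -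
      (starRingEnd ℂ) (f R) * g R).im = 0 ∧
    c * ‖f 0‖ ^ 2 - (c - m * R) * ‖f R‖ ^ 2 ≤
      -((∫ x in 0..R, (starRingEnd ℂ) (f x) * χ x) + (starRingEnd ℂ) (f 0) * g 0 -
      (starRingEnd ℂ) (f R) * g R).re + (m + c ^ 2) * ‖ψ‖ ^ 2 := by
  have h0s : (0 : ℝ) ∈ s := hs (left_mem_Icc.2 hR)
  have hRs : R ∈ s := hs (right_mem_Icc.2 hR)
  have hfa := h.ac 0 h0s R hRs
  have hga := h.ac_deriv 0 h0s R hRs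
  have hφa : AbsolutelyContinuousOnInterval (fun x : ℝ => ((c - m * x : ℝ) : ℂ)) 0 R := by
    refine ContDiffOn.absolutelyContinuousOnInterval (ContDiff.contDiffOn ?_)
    have : ContDiff ℝ 1 fun x : ℝ => c - m * x :=
      contDiff_const.sub (contDiff_const.mul contDiff_id)
    exact Complex.ofRealCLM.contDiff.comp this
  have hFa : AbsolutelyContinuousOnInterval
      (fun x : ℝ => (starRingEnd ℂ) (f x) * (g x + ((c - m * x : ℝ) : ℂ) * f x)) 0 R :=
    hfa.conj.fun_smul (hga.fun_add (hφa.fun_smul hfa))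
  have hfc := hfa.continuousOn
  have hgc := hga.continuousOn
  have hi1 : IntervalIntegrable (fun x => (starRingEnd ℂ) (f x) * χ x) volume 0 R := by
    refine (intervalIntegrable_iff_integrableOn_Icc_of_le hR).2 ?_
    exact h.integrable_conj_mul.mono_set hs
  have hi2 : IntervalIntegrable (fun x => ‖g x + ((c - m * x : ℝ) : ℂ) * f x‖ ^ 2) volume 0 R := by
    refine ContinuousOn.intervalIntegrable ?_
    exact ((hgc.add (hφa.continuousOn.mul hfc)).norm).pow 2
  have hi3 : IntervalIntegrable (fun x => (m + (c - m * x) ^ 2) * ‖f x‖ ^ 2) volume 0 R := by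
    refine ContinuousOn.intervalIntegrable ?_
    exact (Continuous.continuousOn (by fun_prop)).mul (hfc.norm.pow 2)
  have hi4 : IntervalIntegrable (fun x => ((‖g x + ((c - m * x : ℝ) : ℂ) * f x‖ ^ 2 -
      (m + (c - m * x) ^ 2) * ‖f x‖ ^ 2 : ℝ) : ℂ)) volume 0 R :=
    ⟨(hi2.sub hi3).1.ofReal, (hi2.sub hi3).2.ofReal⟩
  have key := hFa.integral_eq_sub (by
    filter_upwards [h.ae_hasDerivAt hR hs] with x hx hxR
    exact hasDerivAt_conj_mul (c := c) (m := m) (hx hxR).1 (hx hxR).2)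
    (hi1.add hi4)
  rw [intervalIntegral.integral_add hi1 hi4, intervalIntegral.integral_ofReal,
    intervalIntegral.integral_sub hi2 hi3] at key
  set J := ∫ x in 0..R, (starRingEnd ℂ) (f x) * χ x
  set r2 := ∫ x in 0..R, ‖g x + ((c - m * x : ℝ) : ℂ) * f x‖ ^ 2 with hr2
  set r3 := ∫ x in 0..R, (m + (c - m * x) ^ 2) * ‖f x‖ ^ 2 with hr3
  have h2 : 0 ≤ r2 := intervalIntegral.integral_nonneg hR fun x _ => by positivity
  have h3 : r3 ≤ (m + c ^ 2) * ‖ψ‖ ^ 2 := by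
    rw [h.norm_sq_eq, hr3, intervalIntegral.integral_of_le hR]
    have hc0 : 0 ≤ c := by nlinarith [mul_nonneg hm hR]
    have hsub : Ioc 0 R ⊆ s := Ioc_subset_Icc_self.trans hs
    calc _ ≤ ∫ x in Ioc 0 R, (m + c ^ 2) * ‖f x‖ ^ 2 := by
            refine setIntegral_mono_on hi3.1 ((h.integrableOn_norm_sq.mono_set hsub).const_mul _)
              measurableSet_Ioc fun x hx => ?_
            refine mul_le_mul_of_nonneg_right ?_ (by positivity)
            have : m * x ≤ m * R := mul_le_mul_of_nonneg_left hx.2 hm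
            have : 0 ≤ m * x := mul_nonneg hm hx.1.le
            nlinarith
      _ ≤ ∫ x in s, (m + c ^ 2) * ‖f x‖ ^ 2 := by
            refine setIntegral_mono_set (h.integrableOn_norm_sq.const_mul _)
              (Eventually.of_forall fun x => by positivity) hsub.eventuallyLE
      _ = _ := integral_const_mul _ _
  have e : ∀ x, (starRingEnd ℂ) (f x) * (g x + ((c - m * x : ℝ) : ℂ) * f x) =
      (starRingEnd ℂ) (f x) * g x + (((c - m * x) * ‖f x‖ ^ 2 : ℝ) : ℂ) := fun x => by
    have := Complex.conj_mul' (f x)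
    push_cast at this ⊢
    linear_combination ((c : ℂ) - m * x) * this
  rw [e, e] at key
  have kre := congrArg Complex.re key
  have kim := congrArg Complex.im key
  simp only [Complex.add_re, Complex.sub_re, Complex.add_im, Complex.sub_im, Complex.ofReal_re,
    Complex.ofReal_im, mul_zero, sub_zero] at kre kim ⊢
  constructor
  · linarith
  · linarith

/-- On a half-line, `ψ` and `ψ'` are simultaneously small at arbitrarily large points. The bound on
`ψ'(x)` comes from `ψ(x + 1) - ψ(x) = ψ'(x) + O(∫ |ψ''|)`, the integral being over `[x, x + 1]`. -/
theorem IsRep.exists_small {ψ χ : Lp ℂ 2 (volume.restrict (Ici (0 : ℝ)))} {f g : ℝ → ℂ}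
    (h : IsRep ψ χ f g) {ε : ℝ} (hε : 0 < ε) (N : ℝ) :
    ∃ x, N ≤ x ∧ 0 ≤ x ∧ ‖f x‖ ≤ ε ∧ ‖g x‖ ≤ ε := by
  have hχ2 : IntegrableOn (fun x => ‖χ x‖ ^ 2) (Ioi 0) :=
    (MetricGraph.integrableOn_norm_sq χ).mono_set Ioi_subset_Ici_self
  have hχi : ∀ x y : ℝ, 0 ≤ x → 0 ≤ y → IntervalIntegrable (fun x => ‖χ x‖ ^ 2) volume x y :=
    fun x y hx hy => (intervalIntegrable_iff.2 (hχ2.mono_set fun z hz =>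
      lt_of_le_of_lt (le_min hx hy) hz.1))
  have hχm : ∀ x y : ℝ, 0 ≤ x → 0 ≤ y → IntervalIntegrable (fun x => χ x) volume x y := by
    intro x y hx hy
    rw [intervalIntegrable_iff]
    have hsub : uIoc x y ⊆ Ici 0 := fun z hz => (lt_of_le_of_lt (le_min hx hy) hz.1).le
    have h2 : MemLp (χ : ℝ → ℂ) 2 (volume.restrict (uIoc x y)) :=
      (Lp.memLp χ).mono_measure (Measure.restrict_mono hsub le_rfl)
    have : IsFiniteMeasure (volume.restrict (uIoc x y)) := by
      rw [uIoc]; infer_instance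
    exact h2.integrable (by norm_num)
  have htail : Tendsto (fun x : ℝ => ∫ t in x..x + 1, ‖χ t‖ ^ 2) atTop (𝓝 0) := by
    have h1 := intervalIntegral_tendsto_integral_Ioi 0 hχ2 tendsto_id
    have h2 := intervalIntegral_tendsto_integral_Ioi 0 hχ2
      (tendsto_atTop_add_const_right atTop (1 : ℝ) tendsto_id)
    have h3 := h2.sub h1
    rw [sub_self] at h3
    refine h3.congr' ?_
    filter_upwards [eventually_ge_atTop 0] with x hx
    simp only [id]
    rw [intervalIntegral.integral_interval_sub_left (hχi _ _ le_rfl (by linarith))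
      (hχi _ _ le_rfl hx)]
  have hf2 : IntegrableOn (fun x => ‖f x‖ ^ 2) (Ioi 0) :=
    h.integrableOn_norm_sq.mono_set Ioi_subset_Ici_self
  have hf3 : IntegrableOn (fun x => ‖f (x + 1)‖ ^ 2) (Ioi 0) := by
    have h1 := ((measurePreserving_add_right volume (1 : ℝ)).integrableOn_comp_preimage
      (measurableEmbedding_addRight 1)).2 (hf2.mono_set (Ioi_subset_Ioi zero_le_one))
    have h2 : (fun x : ℝ => x + 1) ⁻¹' Ioi 1 = Ioi 0 := by ext x; simp
    rwa [h2] at h1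
  obtain ⟨δ, hδ, hδε⟩ : ∃ δ : ℝ, 0 < δ ∧ 4 * δ ≤ ε := ⟨ε / 4, by positivity, by linarith⟩
  obtain ⟨N₁, hN₁⟩ := eventually_atTop.1 (htail.eventually_lt_const (show 0 < δ ^ 2 by positivity))
  set M := max (max N N₁) 0 with hM
  -- an integrable function on a half-line is small at arbitrarily large points
  obtain ⟨x, hxM, hx⟩ : ∃ x, M < x ∧ ‖f x‖ ^ 2 + ‖f (x + 1)‖ ^ 2 < δ ^ 2 := by
    by_contra! hcon
    have hi : IntegrableOn (fun x => ‖f x‖ ^ 2 + ‖f (x + 1)‖ ^ 2) (Ioi M) :=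
      (hf2.add hf3).mono_set (Ioi_subset_Ioi (le_max_right _ _))
    have h1 := Integrable.measure_ge_lt_top hi (show 0 < δ ^ 2 by positivity)
    have h2 : (volume.restrict (Ioi M)) (Ioi M) ≤ (volume.restrict (Ioi M))
        {a | δ ^ 2 ≤ ‖f a‖ ^ 2 + ‖f (a + 1)‖ ^ 2} := measure_mono fun x hx => hcon x hx
    have h3 := h2.trans_lt h1
    simp at h3
  have hx0 : 0 ≤ x := (le_max_right _ _).trans hxM.le
  have hxN : N ≤ x := ((le_max_left _ _).trans (le_max_left _ _)).trans hxM.le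
  have hxN1 : N₁ ≤ x := ((le_max_right _ _).trans (le_max_left _ _)).trans hxM.le
  have hfx : ‖f x‖ ≤ δ := by
    refine abs_le_of_sq_le_sq' (a := ‖f x‖) ?_ hδ.le |>.2
    nlinarith [sq_nonneg ‖f (x + 1)‖]
  have hfx1 : ‖f (x + 1)‖ ≤ δ := by
    refine abs_le_of_sq_le_sq' (a := ‖f (x + 1)‖) ?_ hδ.le |>.2
    nlinarith [sq_nonneg ‖f x‖]
  have hsub : Icc x (x + 1) ⊆ Ici (0 : ℝ) := fun y hy => hx0.trans hy.1
  -- `‖χ‖ ≤ δ / 2 + ‖χ‖ ^ 2 / (2 * δ)`, where the tail of `∫ ‖χ‖ ^ 2` is small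
  have hg : ∀ t ∈ Icc x (x + 1), ‖g t - g x‖ ≤ δ := by
    intro t ht
    have hts : Icc x t ⊆ Ici (0 : ℝ) := fun y hy => hx0.trans hy.1
    have e1 := (h.ac_deriv x hx0 t (hx0.trans ht.1)).integral_eq_sub (F' := χ) (by
      filter_upwards [h.ae_hasDerivAt ht.1 hts] with y hy hyt using (hy hyt).2)
      (hχm _ _ hx0 (hx0.trans ht.1))
    rw [← e1]
    have hn := (hχm x (x + 1) hx0 (by linarith)).norm
    calc ‖∫ y in x..t, χ y‖ ≤ ∫ y in x..t, ‖χ y‖ :=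
          intervalIntegral.norm_integral_le_integral_norm ht.1
      _ ≤ ∫ y in x..x + 1, ‖χ y‖ :=
          intervalIntegral.integral_mono_interval le_rfl ht.1 ht.2
            (Eventually.of_forall fun y => norm_nonneg _) hn
      _ ≤ ∫ y in x..x + 1, (δ / 2 + 1 / (2 * δ) * ‖χ y‖ ^ 2) := by
          refine intervalIntegral.integral_mono_on (by linarith) hn
            (intervalIntegrable_const.add ((hχi x (x + 1) hx0 (by linarith)).const_mul _)) ?_
          intro y _
          have : 0 ≤ (δ - ‖χ y‖) ^ 2 / (2 * δ) := by positivity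
          have e : (δ - ‖χ y‖) ^ 2 / (2 * δ) =
            δ / 2 + 1 / (2 * δ) * ‖χ y‖ ^ 2 - ‖χ y‖ := by field_simp; ring
          linarith
      _ = δ / 2 + 1 / (2 * δ) * ∫ y in x..x + 1, ‖χ y‖ ^ 2 := by
          rw [intervalIntegral.integral_add intervalIntegrable_const
            ((hχi x (x + 1) hx0 (by linarith)).const_mul _),
            intervalIntegral.integral_const_mul]
          simp
      _ ≤ δ / 2 + 1 / (2 * δ) * δ ^ 2 := by
          have := (hN₁ x hxN1).le
          gcongr
      _ = δ := by field_simp; ring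
  -- mean value inequality for `t ↦ f t - t * g x`
  have hmv := (convex_Icc x (x + 1)).norm_image_sub_le_of_norm_hasDerivWithin_le
    (f := fun t : ℝ => f t - (t : ℂ) * g x) (f' := fun t => g t - g x) (C := δ)
    (fun t ht => by
      have h1 := (h.deriv t (hsub ht)).mono hsub
      have h2 : HasDerivWithinAt (fun t : ℝ => (t : ℂ) * g x) (g x) (Icc x (x + 1)) t := by
        simpa using ((hasDerivAt_id t).ofReal_comp.mul_const (g x)).hasDerivWithinAt
      exact h1.fun_sub h2) hg
    (left_mem_Icc.2 (by linarith)) (right_mem_Icc.2 (by linarith))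
  have hmv' : ‖f (x + 1) - f x - g x‖ ≤ δ := by
    refine le_trans (le_of_eq ?_) (hmv.trans (by simp))
    congr 1
    push_cast
    ring
  refine ⟨x, hxN, hx0, by linarith, ?_⟩
  have e : g x = f (x + 1) - f x - (f (x + 1) - f x - g x) := by ring
  calc ‖g x‖ ≤ ‖f (x + 1)‖ + ‖f x‖ + ‖f (x + 1) - f x - g x‖ := by
        nth_rewrite 1 [e]
        exact (norm_sub_le _ _).trans (by gcongr; exact norm_sub_le _ _)
    _ ≤ ε := by linarith

/-- Integration by parts and a trace estimate on a half-line, the limit of those on `[0, R]` along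
a sequence on which the boundary terms at `R` vanish. -/
theorem IsRep.green_Ici {ψ χ : Lp ℂ 2 (volume.restrict (Ici (0 : ℝ)))} {f g : ℝ → ℂ}
    (h : IsRep ψ χ f g) {c : ℝ} (hc : 0 ≤ c) :
    (inner ℂ ψ χ + (starRingEnd ℂ) (f 0) * g 0).im = 0 ∧
    c * ‖f 0‖ ^ 2 ≤ -(inner ℂ ψ χ + (starRingEnd ℂ) (f 0) * g 0).re + c ^ 2 * ‖ψ‖ ^ 2 := by
  choose x hxn hx0 hxf hxg using fun n : ℕ =>
    h.exists_small (ε := 1 / ((n : ℝ) + 1)) (by positivity) n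
  have hx : Tendsto x atTop atTop := tendsto_atTop_mono hxn tendsto_natCast_atTop_atTop
  have hf : Tendsto (fun n => f (x n)) atTop (𝓝 0) :=
    squeeze_zero_norm hxf tendsto_one_div_add_atTop_nhds_zero_nat
  have hg : Tendsto (fun n => g (x n)) atTop (𝓝 0) :=
    squeeze_zero_norm hxg tendsto_one_div_add_atTop_nhds_zero_nat
  have hJ : Tendsto (fun n => ∫ t in 0..x n, (starRingEnd ℂ) (f t) * χ t) atTop
      (𝓝 (inner ℂ ψ χ)) := by
    rw [h.inner_eq, integral_Ici_eq_integral_Ioi]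
    exact intervalIntegral_tendsto_integral_Ioi 0
      (h.integrable_conj_mul.mono_set Ioi_subset_Ici_self) hx
  have hz : Tendsto (fun n => (∫ t in 0..x n, (starRingEnd ℂ) (f t) * χ t) +
      (starRingEnd ℂ) (f 0) * g 0 - (starRingEnd ℂ) (f (x n)) * g (x n)) atTop
      (𝓝 (inner ℂ ψ χ + (starRingEnd ℂ) (f 0) * g 0)) := by
    have hc := (Complex.continuous_conj.tendsto 0).comp hf
    simpa using (hJ.add_const ((starRingEnd ℂ) (f 0) * g 0)).sub (hc.mul hg)
  have hgr := fun n => h.green_Icc (c := c) (m := 0) (hx0 n) Icc_subset_Ici_self le_rfl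
    (by linarith)
  refine ⟨?_, ?_⟩
  · refine tendsto_nhds_unique ((Complex.continuous_im.tendsto _).comp hz) ?_
    refine tendsto_const_nhds.congr fun n => ?_
    exact (hgr n).1.symm
  · have hl : Tendsto (fun n => c * ‖f 0‖ ^ 2 - (c - 0 * x n) * ‖f (x n)‖ ^ 2) atTop
        (𝓝 (c * ‖f 0‖ ^ 2)) := by
      simpa using ((hf.norm.pow 2).const_mul c).const_sub (c * ‖f 0‖ ^ 2)
    refine le_of_tendsto_of_tendsto' hl ?_ fun n => (hgr n).2
    have := ((Complex.continuous_re.tendsto _).comp hz).neg.add_const ((0 + c ^ 2) * ‖ψ‖ ^ 2)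
    simpa using this

/-! ### Functions with absolutely continuous derivative -/

/-- `f` is continuously differentiable on `ℝ` with derivative `g`, which is locally absolutely
continuous with derivative `h` almost everywhere. -/
structure IsTwiceAC (f g h : ℝ → ℂ) : Prop where
  deriv : ∀ x, HasDerivAt f (g x) x
  ac_deriv : ∀ a b, AbsolutelyContinuousOnInterval g a b
  deriv_two : ∀ᵐ x, HasDerivAt g (h x) x

theorem continuous_of_ac {f : ℝ → ℂ} (hf : ∀ a b, AbsolutelyContinuousOnInterval f a b) :
    Continuous f := by
  refine continuous_iff_continuousAt.2 fun x => ?_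
  have h := (hf (x - 1) (x + 1)).continuousOn
  rw [uIcc_of_le (by linarith)] at h
  exact h.continuousAt (Icc_mem_nhds (by linarith) (by linarith))

namespace IsTwiceAC

variable {f g h : ℝ → ℂ}

theorem continuous (H : IsTwiceAC f g h) : Continuous f :=
  continuous_iff_continuousAt.2 fun x => (H.deriv x).continuousAt

theorem contDiff (H : IsTwiceAC f g h) : ContDiff ℝ 1 f := by
  refine contDiff_one_iff_deriv.2 ⟨fun x => (H.deriv x).differentiableAt, ?_⟩
  rw [show _root_.deriv f = g from funext fun x => (H.deriv x).deriv]
  exact continuous_of_ac H.ac_deriv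

theorem isRep (H : IsTwiceAC f g h) {s : Set ℝ} (hf : MemLp f 2 (volume.restrict s))
    (hh : MemLp h 2 (volume.restrict s)) : IsRep (hf.toLp f) (hh.toLp h) f g where
  ae_eq := hf.coeFn_toLp
  ac a _ b _ := H.contDiff.contDiffOn.absolutelyContinuousOnInterval
  deriv x _ := (H.deriv x).hasDerivWithinAt
  ac_deriv a _ b _ := H.ac_deriv a b
  deriv_two := by
    filter_upwards [ae_restrict_of_ae H.deriv_two, hh.coeFn_toLp] with x h1 h2
    rw [h2]
    exact h1.hasDerivWithinAt

theorem of_hasDerivAt (h1 : ∀ x, HasDerivAt f (g x) x) (h2 : ∀ x, HasDerivAt g (h x) x)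
    (hc : Continuous h) : IsTwiceAC f g h where
  deriv := h1
  ac_deriv a b := by
    have : ContDiff ℝ 1 g := by
      refine contDiff_one_iff_deriv.2 ⟨fun x => (h2 x).differentiableAt, ?_⟩
      rwa [show _root_.deriv g = h from funext fun x => (h2 x).deriv]
    exact this.contDiffOn.absolutelyContinuousOnInterval
  deriv_two := Eventually.of_forall h2

/-- For absolutely continuous `f` and `g` it suffices that `f' = g` almost everywhere. -/
theorem of_ae (hf : ∀ a b, AbsolutelyContinuousOnInterval f a b)
    (hg : ∀ a b, AbsolutelyContinuousOnInterval g a b) (h1 : ∀ᵐ x, HasDerivAt f (g x) x)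
    (h2 : ∀ᵐ x, HasDerivAt g (h x) x) : IsTwiceAC f g h where
  deriv x := by
    have hc := continuous_of_ac hg
    have e : f = fun x => f 0 + ∫ t in (0 : ℝ)..x, g t := by
      ext x
      rw [(hf 0 x).integral_eq_sub (by filter_upwards [h1] with y hy _ using hy)
        (hc.intervalIntegrable _ _)]
      ring
    rw [e]
    exact (hc.integral_hasStrictDerivAt 0 x).hasDerivAt.const_add _
  ac_deriv := hg
  deriv_two := h2

end IsTwiceAC

/-! ### Exponential solutions of the homogeneous equation -/

theorem hasDerivAt_cexp_mul (k : ℂ) (x : ℝ) :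
    HasDerivAt (fun x : ℝ => Complex.exp (k * x)) (k * Complex.exp (k * x)) x := by
  have h1 : HasDerivAt (fun x : ℝ => k * (x : ℂ)) k x := by
    simpa using (hasDerivAt_id x).ofReal_comp.const_mul k
  simpa [mul_comm] using h1.cexp

/-- The general solution of `f'' = κ² f`. -/
theorem isTwiceAC_exp (κ : ℝ) (α β : ℂ) :
    IsTwiceAC (fun x => α * Complex.exp (κ * x) + β * Complex.exp (-κ * x))
      (fun x => κ * (α * Complex.exp (κ * x) - β * Complex.exp (-κ * x)))
      (fun x => κ ^ 2 * (α * Complex.exp (κ * x) + β * Complex.exp (-κ * x))) := by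
  have h := hasDerivAt_cexp_mul
  refine .of_hasDerivAt (fun x => ?_) (fun x => ?_) (by fun_prop)
  · refine (((h κ x).const_mul α).add ((h (-κ) x).const_mul β)).congr_deriv ?_
    ring
  · refine ((((h κ x).const_mul α).fun_sub ((h (-κ) x).const_mul β)).const_mul
      (κ : ℂ)).congr_deriv ?_
    ring

theorem norm_cexp_ofReal_mul (k x : ℝ) : ‖Complex.exp ((k : ℂ) * x)‖ = Real.exp (k * x) := by
  rw [Complex.norm_exp]
  simp

theorem memLp_cexp_Ioi {k : ℝ} (hk : 0 < k) (a : ℝ) :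
    MemLp (fun x : ℝ => Complex.exp (-(k : ℂ) * x)) 2 (volume.restrict (Ioi a)) := by
  rw [memLp_two_iff_integrable_sq_norm (Continuous.aestronglyMeasurable (by fun_prop))]
  refine (integrableOn_exp_mul_Ioi (a := -(2 * k)) (by linarith) a).congr ?_
  refine Eventually.of_forall fun x => ?_
  have := norm_cexp_ofReal_mul (-k) x
  push_cast at this
  simp only [this, ← Real.exp_nat_mul]
  congr 1
  push_cast
  ring

theorem memLp_cexp_Iic {k : ℝ} (hk : 0 < k) (a : ℝ) :
    MemLp (fun x : ℝ => Complex.exp ((k : ℂ) * x)) 2 (volume.restrict (Iic a)) := by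
  rw [memLp_two_iff_integrable_sq_norm (Continuous.aestronglyMeasurable (by fun_prop))]
  refine (integrableOn_exp_mul_Iic (a := 2 * k) (by linarith) a).congr ?_
  refine Eventually.of_forall fun x => ?_
  simp only [norm_cexp_ofReal_mul k x, ← Real.exp_nat_mul]
  congr 1
  push_cast
  ring

theorem memLp_of_continuous_Icc {f : ℝ → ℂ} (hf : Continuous f) (a b : ℝ) :
    MemLp f 2 (volume.restrict (Icc a b)) := by
  obtain ⟨C, hC⟩ := isCompact_Icc.exists_bound_of_continuousOn (s := Icc a b) hf.continuousOn
  refine MemLp.of_bound hf.aestronglyMeasurable C ?_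
  exact (ae_restrict_iff' measurableSet_Icc).2 (Eventually.of_forall hC)

/-! ### Test functions concentrated near an end point -/

theorem hasDerivAt_max_zero_sq (y : ℝ) :
    HasDerivAt (fun y : ℝ => max 0 y ^ 2) (2 * max 0 y) y := by
  rcases lt_trichotomy y 0 with hy | rfl | hy
  · rw [max_eq_left hy.le, mul_zero]
    refine (hasDerivAt_const y (0 : ℝ)).congr_of_eventuallyEq ?_
    filter_upwards [Iio_mem_nhds hy] with z hz
    rw [max_eq_left (le_of_lt hz)]; ring
  · rw [hasDerivAt_iff_isLittleO_nhds_zero]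
    have h : (fun h : ℝ => h ^ 2) =o[𝓝 0] fun h => h := by
      simpa using Asymptotics.isLittleO_pow_id (𝕜 := ℝ) one_lt_two
    refine (Asymptotics.IsBigO.of_bound 1 (Eventually.of_forall fun z => ?_)).trans_isLittleO h
    simp only [zero_add, max_self, mul_zero, smul_zero, sub_zero, one_mul, norm_pow]
    simp only [ne_eq, OfNat.ofNat_ne_zero, not_false_eq_true, zero_pow, sub_zero, norm_pow]
    gcongr
    rw [Real.norm_eq_abs, Real.norm_eq_abs, abs_of_nonneg (le_max_left _ _)]
    exact max_le (abs_nonneg _) (le_abs_self _)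
  · rw [max_eq_right hy.le]
    refine (by simpa using hasDerivAt_pow 2 y : HasDerivAt (fun y : ℝ => y ^ 2) (2 * y) y
      ).congr_of_eventuallyEq ?_
    filter_upwards [Ioi_mem_nhds hy] with z hz
    rw [max_eq_right (le_of_lt hz)]

theorem hasDerivAt_max_zero {y : ℝ} (hy : y ≠ 0) :
    HasDerivAt (fun y : ℝ => max 0 y) (if 0 < y then 1 else 0) y := by
  rcases lt_or_gt_of_ne hy with hy | hy
  · rw [if_neg hy.le.not_gt]
    refine (hasDerivAt_const y (0 : ℝ)).congr_of_eventuallyEq ?_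
    filter_upwards [Iio_mem_nhds hy] with z hz
    rw [max_eq_left (le_of_lt hz)]
  · rw [if_pos hy]
    refine (hasDerivAt_id y).congr_of_eventuallyEq ?_
    filter_upwards [Ioi_mem_nhds hy] with z hz
    rw [max_eq_right (le_of_lt hz), id]

/-- The function `e β (x - x₀) (1 - σ / δ)₊²`, where `σ = e (x - x₀)` and `e = ±1`, written in terms
of `y = 1 - σ / δ`. Its derivative at `x₀` in the direction of `e` is `β`. -/
theorem isTwiceAC_bump {e δ : ℝ} (he : e ^ 2 = 1) (hδ : 0 < δ) (x₀ : ℝ) (β : ℂ) :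
    IsTwiceAC
      (fun x => β *
        ((δ * ((1 - (1 - e * (x - x₀) / δ)) * max 0 (1 - e * (x - x₀) / δ) ^ 2) : ℝ) : ℂ))
      (fun x => β * ((e * (max 0 (1 - e * (x - x₀) / δ) ^ 2 -
        2 * (1 - (1 - e * (x - x₀) / δ)) * max 0 (1 - e * (x - x₀) / δ)) : ℝ) : ℂ))
      (fun x => β * (((if 0 < 1 - e * (x - x₀) / δ then 2 - 6 * (1 - e * (x - x₀) / δ) else 0) / δ
        : ℝ) : ℂ)) where
  deriv x := by
    have hy : HasDerivAt (fun x : ℝ => 1 - e * (x - x₀) / δ) (-(e / δ)) x := by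
      simpa using ((((hasDerivAt_id x).sub_const x₀).const_mul e).div_const δ).const_sub 1
    have hm := (hasDerivAt_max_zero_sq (1 - e * (x - x₀) / δ)).comp x hy
    refine ((((hy.const_sub 1).fun_mul hm).const_mul δ).ofReal_comp.const_mul β).congr_deriv ?_
    congr 2
    simp only [Function.comp]
    field_simp
    ring
  ac_deriv a b := by
    have hy : LipschitzOnWith (Real.toNNReal (|e| / δ)) (fun x : ℝ => 1 - e * (x - x₀) / δ)
        (uIcc a b) := by
      refine LipschitzOnWith.of_dist_le_mul fun x _ y _ => le_of_eq ?_
      rw [Real.dist_eq, Real.dist_eq, Real.coe_toNNReal _ (by positivity), ← abs_of_pos hδ,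
        ← abs_div, ← abs_mul, abs_of_pos hδ, abs_sub_comm (1 - e * (x - x₀) / δ)]
      congr 1
      ring
    have hya := hy.absolutelyContinuousOnInterval
    have hma : AbsolutelyContinuousOnInterval (fun x : ℝ => max 0 (1 - e * (x - x₀) / δ)) a b :=
      LipschitzOnWith.absolutelyContinuousOnInterval (K := Real.toNNReal (|e| / δ))
        (LipschitzOnWith.of_dist_le_mul fun x hx y hy' => by
          refine le_trans ?_ (hy.dist_le_mul x hx y hy')
          rw [Real.dist_eq, Real.dist_eq, max_comm 0, max_comm 0]
          exact abs_max_sub_max_le_abs _ _ _)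
    have h1 : ∀ c : ℝ, AbsolutelyContinuousOnInterval (fun _ : ℝ => c) a b := fun c =>
      (LipschitzWith.const c).lipschitzOnWith.absolutelyContinuousOnInterval
    have hc : AbsolutelyContinuousOnInterval (fun _ : ℝ => β) a b :=
      (LipschitzWith.const β).lipschitzOnWith.absolutelyContinuousOnInterval
    have hr := ((((hma.fun_mul hma).fun_sub
      (((h1 2).fun_mul ((h1 1).fun_sub hya)).fun_mul hma)).const_mul e).fun_smul hc)
    refine hr.congr_fun ?_
    intro x
    simp only [Complex.real_smul]
    rw [mul_comm]
    congr 3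
    ring
  deriv_two := by
    have hne : ∀ᵐ x : ℝ, x ≠ x₀ + e * δ := by simp [ae_iff, measure_singleton]
    filter_upwards [hne] with x hx
    have hy : HasDerivAt (fun x : ℝ => 1 - e * (x - x₀) / δ) (-(e / δ)) x := by
      simpa using ((((hasDerivAt_id x).sub_const x₀).const_mul e).div_const δ).const_sub 1
    have hy0 : 1 - e * (x - x₀) / δ ≠ 0 := by
      intro h0
      apply hx
      have : e * (x - x₀) = δ := by field_simp at h0; linarith
      linear_combination e * this - (x - x₀) * he
    have hm := (hasDerivAt_max_zero_sq (1 - e * (x - x₀) / δ)).comp x hy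
    have hm1 := (hasDerivAt_max_zero hy0).comp x hy
    refine (((hm.fun_sub (((hy.const_sub 1).const_mul 2).fun_mul hm1)).const_mul
      e).ofReal_comp.const_mul β).congr_deriv ?_
    congr 2
    simp only [Function.comp]
    split_ifs with h
    · rw [max_eq_right h.le]
      generalize 1 - e * (x - x₀) / δ = y
      linear_combination (2 - 6 * y) / δ * he
    · rw [max_eq_left (not_lt.1 h)]
      simp

/-- A bounded function supported in a ball of radius `δ` has small norm in `L²` for small `δ`. -/
theorem memLp_of_bound_of_support {f : ℝ → ℂ} {s : Set ℝ} {x₀ δ C : ℝ} (hδ : 0 < δ)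
    (hs : MeasurableSet s) (hf : AEStronglyMeasurable f volume) (hC : 0 ≤ C)
    (hb : ∀ x ∈ s, ‖f x‖ ≤ C) (h0 : ∀ x ∈ s, δ < |x - x₀| → f x = 0) :
    ∃ hm : MemLp f 2 (volume.restrict s), ‖hm.toLp f‖ ≤ C * Real.sqrt (2 * δ) := by
  have hle : eLpNorm f 2 (volume.restrict s) ≤ ENNReal.ofReal (C * Real.sqrt (2 * δ)) := by
    calc eLpNorm f 2 (volume.restrict s)
        ≤ eLpNorm ((Metric.closedBall x₀ δ).indicator fun _ => C) 2 (volume.restrict s) := by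
          refine eLpNorm_mono_ae ((ae_restrict_iff' hs).2 (Eventually.of_forall fun x hx => ?_))
          by_cases hxb : x ∈ Metric.closedBall x₀ δ
          · rw [indicator_of_mem hxb, Real.norm_of_nonneg hC]
            exact hb x hx
          · rw [h0 x hx (by simpa [Real.dist_eq] using hxb)]
            simp
      _ ≤ eLpNorm ((Metric.closedBall x₀ δ).indicator fun _ => C) 2 volume :=
          eLpNorm_mono_measure _ Measure.restrict_le_self
      _ = ENNReal.ofReal (C * Real.sqrt (2 * δ)) := by
          rw [eLpNorm_indicator_const Metric.isClosed_closedBall.measurableSet (by norm_num)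
            (by norm_num), Real.volume_closedBall, ENNReal.ofReal_mul hC, Real.enorm_of_nonneg hC,
            Real.sqrt_eq_rpow, ENNReal.ofReal_rpow_of_nonneg (by positivity) (by norm_num)]
          simp
  have hm : MemLp f 2 (volume.restrict s) := ⟨hf.restrict, hle.trans_lt ENNReal.ofReal_lt_top⟩
  refine ⟨hm, ?_⟩
  rw [Lp.norm_toLp]
  exact ENNReal.toReal_le_of_le_ofReal (by positivity) hle

/-! ### The resolvent of the second derivative on the line -/

/-- Young's inequality for the convolution of a function in `L¹`, written as `k ^ 2`, with a
function in `L²`. -/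
theorem lintegral_convolution_sq_le {k φ : ℝ → ℝ≥0∞} (hk : Measurable k) (hφ : Measurable φ) :
    ∫⁻ x, (∫⁻ t, k (x - t) * k (x - t) * φ t) ^ 2 ≤ (∫⁻ x, k x ^ 2) ^ 2 * ∫⁻ x, φ x ^ 2 := by
  -- Cauchy-Schwarz for the factors `k` and `k * φ`
  have hcs : ∀ x, (∫⁻ t, k (x - t) * k (x - t) * φ t) ^ 2 ≤
      (∫⁻ x, k x ^ 2) * ∫⁻ t, k (x - t) ^ 2 * φ t ^ 2 := by
    intro x
    have h := ENNReal.lintegral_mul_le_Lp_mul_Lq volume Real.HolderConjugate.two_two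
      (f := fun t => k (x - t)) (g := fun t => k (x - t) * φ t)
      (by fun_prop) (by fun_prop)
    simp only [Pi.mul_apply, ENNReal.rpow_two] at h
    have e : ∀ z : ℝ≥0∞, (z ^ (1 / 2 : ℝ)) ^ 2 = z := fun z => by
      rw [← ENNReal.rpow_natCast, ← ENNReal.rpow_mul]; norm_num
    calc (∫⁻ t, k (x - t) * k (x - t) * φ t) ^ 2
        ≤ ((∫⁻ t, k (x - t) ^ 2) ^ (1 / 2 : ℝ) *
            (∫⁻ t, (k (x - t) * φ t) ^ 2) ^ (1 / 2 : ℝ)) ^ 2 := by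
          simp only [mul_assoc]
          gcongr
      _ = (∫⁻ x, k x ^ 2) * ∫⁻ t, k (x - t) ^ 2 * φ t ^ 2 := by
          rw [mul_pow, e, e, lintegral_sub_left_eq_self (fun y => k y ^ 2) x]
          simp only [mul_pow]
  calc ∫⁻ x, (∫⁻ t, k (x - t) * k (x - t) * φ t) ^ 2
      ≤ ∫⁻ x, (∫⁻ x, k x ^ 2) * ∫⁻ t, k (x - t) ^ 2 * φ t ^ 2 := lintegral_mono hcs
    _ = (∫⁻ x, k x ^ 2) * ∫⁻ x, ∫⁻ t, k (x - t) ^ 2 * φ t ^ 2 := by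
        rw [lintegral_const_mul]
        exact Measurable.lintegral_prod_right' (f := fun p : ℝ × ℝ => k (p.1 - p.2) ^ 2 * φ p.2 ^ 2)
          (by fun_prop)
    _ = (∫⁻ x, k x ^ 2) * ∫⁻ t, ∫⁻ x, k (x - t) ^ 2 * φ t ^ 2 := by
        rw [lintegral_lintegral_swap]
        exact Measurable.aemeasurable (by unfold Function.uncurry; fun_prop)
    _ = (∫⁻ x, k x ^ 2) * ∫⁻ t, (∫⁻ x, k x ^ 2) * φ t ^ 2 := by
        congr 2
        ext t
        rw [lintegral_mul_const _ (by fun_prop), lintegral_sub_right_eq_self (fun y => k y ^ 2) t]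
    _ = (∫⁻ x, k x ^ 2) ^ 2 * ∫⁻ x, φ x ^ 2 := by
        rw [lintegral_const_mul _ (by fun_prop)]
        ring

theorem lintegral_exp_neg_abs_lt_top {κ : ℝ} (hκ : 0 < κ) :
    ∫⁻ x : ℝ, ENNReal.ofReal (Real.exp (-(κ / 2) * |x|)) ^ 2 < ∞ := by
  have h1 : IntegrableOn (fun x : ℝ => Real.exp (-κ * |x|)) (Iic 0) := by
    refine (integrableOn_exp_mul_Iic (a := κ) hκ 0).congr_fun (fun x hx => ?_) measurableSet_Iic
    simp only [abs_of_nonpos (mem_Iic.1 hx), neg_mul_neg]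
  have h2 : IntegrableOn (fun x : ℝ => Real.exp (-κ * |x|)) (Ioi 0) := by
    refine (integrableOn_exp_mul_Ioi (a := -κ) (by linarith) 0).congr_fun (fun x hx => ?_)
      measurableSet_Ioi
    rw [abs_of_pos hx]
  have h3 := h1.union h2
  rw [Iic_union_Ioi, integrableOn_univ] at h3
  have h4 := h3.lintegral_lt_top
  refine lt_of_le_of_lt (le_of_eq ?_) h4
  congr 1
  ext x
  rw [← ENNReal.ofReal_pow (Real.exp_nonneg _), ← Real.exp_nat_mul]
  congr 2
  push_cast
  ring

/-- For `f ∈ L²(ℝ)` and `κ > 0` the equation `-u'' + κ² u = f` has a solution in `L²(ℝ)`, namely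
`u x = (2 κ)⁻¹ ∫ exp (-κ |x - t|) f t dt`. -/
theorem exists_resolvent {κ : ℝ} (hκ : 0 < κ) {f : ℝ → ℂ} (hfm : StronglyMeasurable f)
    (hf : MemLp f 2 volume) :
    ∃ u g : ℝ → ℂ, IsTwiceAC u g (fun x => κ ^ 2 * u x - f x) ∧ MemLp u 2 volume := by
  have hκ0 : (κ : ℂ) ≠ 0 := by exact_mod_cast hκ.ne'
  set p : ℝ → ℂ := fun t => Complex.exp (κ * t) * f t with hp
  set q : ℝ → ℂ := fun t => Complex.exp (-κ * t) * f t with hq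
  have hpi : ∀ x, IntegrableOn p (Iic x) := fun x =>
    (memLp_cexp_Iic hκ x).integrable_mul (hf.restrict _)
  have hqi : ∀ x, IntegrableOn q (Ioi x) := fun x =>
    (memLp_cexp_Ioi hκ x).integrable_mul (hf.restrict _)
  have hpl : ∀ a b, IntervalIntegrable p volume a b := fun a b => by
    rw [intervalIntegrable_iff]
    exact (hpi (max a b)).mono_set fun x hx => hx.2
  have hql : ∀ a b, IntervalIntegrable q volume a b := fun a b => by
    rw [intervalIntegrable_iff]
    exact (hqi (min a b)).mono_set fun x hx => hx.1
  -- The convolution is split at `t = x`: `2 κ u x = exp (-κ x) P x + exp (κ x) Q x`.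
  set P : ℝ → ℂ := fun x => ∫ t in Iic x, p t with hP
  set Q : ℝ → ℂ := fun x => ∫ t in Ioi x, q t with hQ
  have hPe : P = fun x => P 0 + ∫ t in (0 : ℝ)..x, p t := by
    ext x
    rw [← intervalIntegral.integral_Iic_sub_Iic (hpi 0) (hpi x)]
    simp [hP]
  have hQe : Q = fun x => Q 0 - ∫ t in (0 : ℝ)..x, q t := by
    ext x
    rw [← intervalIntegral.integral_Ioi_sub_Ioi' (hqi 0) (hqi x)]
    simp [hQ]
  have hc : ∀ (c : ℂ) (a b : ℝ), AbsolutelyContinuousOnInterval (fun _ : ℝ => c) a b := fun c a b =>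
    (LipschitzWith.const c).lipschitzOnWith.absolutelyContinuousOnInterval
  have hac : ∀ {r : ℝ → ℂ}, (∀ a b, IntervalIntegrable r volume a b) → ∀ a b,
      AbsolutelyContinuousOnInterval (fun x => ∫ t in (0 : ℝ)..x, r t) a b := by
    intro r hr a b
    have h1 := absolutelyContinuousOnInterval_integral (c := a) (hr a b) left_mem_uIcc
    refine ((hc (∫ t in (0 : ℝ)..a, r t) a b).fun_add h1).congr_fun fun x => ?_
    exact intervalIntegral.integral_add_adjacent_intervals (hr _ _) (hr _ _)
  have hPa : ∀ a b, AbsolutelyContinuousOnInterval P a b := fun a b => by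
    rw [hPe]
    exact (hc _ a b).fun_add (hac hpl a b)
  have hQa : ∀ a b, AbsolutelyContinuousOnInterval Q a b := fun a b => by
    rw [hQe]
    exact (hc _ a b).fun_sub (hac hql a b)
  have hli : ∀ {r : ℝ → ℂ}, (∀ a b, IntervalIntegrable r volume a b) →
      LocallyIntegrable r volume := by
    intro r hr
    refine (locallyIntegrable_iff).2 fun K hK => ?_
    obtain ⟨R, hR⟩ := hK.isBounded.subset_closedBall 0
    rw [Real.closedBall_eq_Icc] at hR
    refine IntegrableOn.mono_set ?_ hR
    rcases le_or_gt (0 - R) (0 + R) with h | h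
    · exact (intervalIntegrable_iff_integrableOn_Icc_of_le h).1 (hr _ _)
    · rw [Icc_eq_empty h.not_ge]
      exact integrableOn_empty
  have hPd : ∀ᵐ x, HasDerivAt P (p x) x := by
    filter_upwards [LocallyIntegrable.ae_hasDerivAt_integral (hli hpl)] with x hx
    rw [hPe]
    exact (hx 0).const_add _
  have hQd : ∀ᵐ x, HasDerivAt Q (-q x) x := by
    filter_upwards [LocallyIntegrable.ae_hasDerivAt_integral (hli hql)] with x hx
    rw [hQe]
    exact (hx 0).const_sub _
  have hexp := hasDerivAt_cexp_mul
  have hea : ∀ (k : ℂ) (a b : ℝ),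
      AbsolutelyContinuousOnInterval (fun x : ℝ => Complex.exp (k * x)) a b := fun k a b =>
    (IsTwiceAC.of_hasDerivAt (hexp k) (fun x => (hexp k x).const_mul k)
      (by fun_prop)).contDiff.contDiffOn.absolutelyContinuousOnInterval
  have hee : ∀ x : ℝ, Complex.exp (-κ * x) * Complex.exp (κ * x) = 1 := fun x => by
    rw [← Complex.exp_add]; simp
  set u : ℝ → ℂ := fun x => (2 * κ : ℂ)⁻¹ * (Complex.exp (-κ * x) * P x + Complex.exp (κ * x) * Q x)
    with hu
  set g : ℝ → ℂ := fun x => (2 : ℂ)⁻¹ * (-(Complex.exp (-κ * x) * P x) + Complex.exp (κ * x) * Q x)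
    with hg
  have hua : ∀ a b, AbsolutelyContinuousOnInterval u a b := fun a b =>
    (hc _ a b).fun_smul
      (((hea _ a b).fun_smul (hPa a b)).fun_add ((hea _ a b).fun_smul (hQa a b)))
  have hga : ∀ a b, AbsolutelyContinuousOnInterval g a b := fun a b =>
    (hc _ a b).fun_smul
      (((hea _ a b).fun_smul (hPa a b)).fun_neg.fun_add ((hea _ a b).fun_smul (hQa a b)))
  have H : IsTwiceAC u g (fun x => κ ^ 2 * u x - f x) := by
    refine IsTwiceAC.of_ae hua hga ?_ ?_
    · filter_upwards [hPd, hQd] with x h1 h2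
      refine ((((hexp (-κ) x).fun_mul h1).fun_add ((hexp κ x).fun_mul h2)).const_mul
        (2 * κ : ℂ)⁻¹).congr_deriv ?_
      simp only [hp, hq, hg]
      field_simp
      ring
    · filter_upwards [hPd, hQd] with x h1 h2
      refine ((((hexp (-κ) x).fun_mul h1).fun_neg.fun_add ((hexp κ x).fun_mul h2)).const_mul
        (2 : ℂ)⁻¹).congr_deriv ?_
      simp only [hp, hq, hu]
      have he := hee x
      generalize Complex.exp (-κ * x) = E₁ at he ⊢
      generalize Complex.exp (κ * x) = E₂ at he ⊢
      field_simp
      linear_combination (-2 * f x) * he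
  -- The kernel `exp (-κ |x|)` is the square of `k`.
  refine ⟨u, g, H, H.continuous.aestronglyMeasurable, ?_⟩
  set k : ℝ → ℝ≥0∞ := fun x => ENNReal.ofReal (Real.exp (-(κ / 2) * |x|)) with hk
  have hkk : ∀ x, k x * k x = ENNReal.ofReal (Real.exp (-κ * |x|)) := fun x => by
    rw [hk, ← ENNReal.ofReal_mul (Real.exp_nonneg _), ← Real.exp_add]
    congr 2
    ring
  have hkm : Measurable k := by fun_prop
  have hφm : Measurable fun t => ‖f t‖ₑ := hfm.enorm
  have hbound : ∀ (σ x : ℝ) (s : Set ℝ), MeasurableSet s →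
      (∀ t ∈ s, σ * t - σ * x = -κ * |x - t|) →
      ‖Complex.exp (-(σ : ℂ) * x) * ∫ t in s, Complex.exp ((σ : ℂ) * t) * f t‖ₑ ≤
        ∫⁻ t, k (x - t) * k (x - t) * ‖f t‖ₑ := by
    intro σ x s hs hσ
    rw [← integral_const_mul]
    refine (enorm_integral_le_lintegral_enorm _).trans ?_
    refine le_trans (le_of_eq ?_) (setLIntegral_le_lintegral s _)
    refine setLIntegral_congr_fun hs fun t ht => ?_
    simp only [hkk]
    rw [← mul_assoc, enorm_mul, ← Complex.exp_add]
    congr 1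
    rw [← ofReal_norm, Complex.norm_exp]
    congr 2
    rw [← hσ t ht]
    simp
    ring
  have hub : ∀ x, ‖u x‖ₑ ≤ ‖(2 * κ : ℂ)⁻¹‖ₑ *
      (2 * ∫⁻ t, k (x - t) * k (x - t) * ‖f t‖ₑ) := by
    intro x
    rw [hu, enorm_mul, two_mul (∫⁻ t, k (x - t) * k (x - t) * ‖f t‖ₑ)]
    gcongr
    refine (enorm_add_le _ _).trans (add_le_add ?_ ?_)
    · refine hbound κ x (Iic x) measurableSet_Iic fun t ht => ?_
      rw [abs_of_nonneg (sub_nonneg.2 ht)]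
      ring
    · have := hbound (-κ) x (Ioi x) measurableSet_Ioi fun t ht => by
        rw [abs_of_neg (sub_neg.2 ht)]
        ring
      push_cast at this
      rwa [neg_neg] at this
  have hf2 := hf.2
  rw [eLpNorm_lt_top_iff_lintegral_rpow_enorm_lt_top (by norm_num) (by norm_num)] at hf2 ⊢
  simp only [ENNReal.toReal_ofNat, ENNReal.rpow_two] at hf2 ⊢
  calc ∫⁻ x, ‖u x‖ₑ ^ 2
      ≤ ∫⁻ x, (‖(2 * κ : ℂ)⁻¹‖ₑ * 2) ^ 2 * (∫⁻ t, k (x - t) * k (x - t) * ‖f t‖ₑ) ^ 2 := by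
        refine lintegral_mono fun x => ?_
        rw [← mul_pow, mul_assoc]
        gcongr
        exact hub x
    _ = (‖(2 * κ : ℂ)⁻¹‖ₑ * 2) ^ 2 * ∫⁻ x, (∫⁻ t, k (x - t) * k (x - t) * ‖f t‖ₑ) ^ 2 := by
        rw [lintegral_const_mul' _ _ (by finiteness)]
    _ ≤ (‖(2 * κ : ℂ)⁻¹‖ₑ * 2) ^ 2 * ((∫⁻ x, k x ^ 2) ^ 2 * ∫⁻ x, ‖f x‖ₑ ^ 2) := by
        gcongr
        exact lintegral_convolution_sq_le hkm hφm
    _ < ∞ := by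
        have h1 := lintegral_exp_neg_abs_lt_top hκ
        exact ENNReal.mul_lt_top (by finiteness)
          (ENNReal.mul_lt_top (ENNReal.pow_lt_top h1) hf2)

/-! ### Functions on a single edge -/

/-- The functions of `isTwiceAC_bump` as elements of `L²(s)`, `s` being on the side of `x₀` given by
`e`. With `‖ψ‖ = O(δ ^ (3 / 2))` and `‖χ‖ = O(δ ^ (-1 / 2))`, both `‖ψ‖` and `‖ψ‖ * ‖χ‖` become
small with `δ`. -/
theorem exists_isRep_bump {e x₀ δ B : ℝ} {β : ℂ} {s : Set ℝ} (he : e ^ 2 = 1) (hδ : 0 < δ)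
    (hB : ‖β‖ ≤ B) (hsm : MeasurableSet s) (hs : ∀ x ∈ s, 0 ≤ e * (x - x₀)) :
    ∃ (ψ χ : Lp ℂ 2 (volume.restrict s)) (f g : ℝ → ℂ), IsRep ψ χ f g ∧
      f x₀ = 0 ∧ g x₀ = e * β ∧ (∀ x, δ ≤ e * (x - x₀) → f x = 0 ∧ g x = 0) ∧
      ‖ψ‖ ≤ B * δ * Real.sqrt (2 * δ) ∧ ‖χ‖ ≤ 4 * B / δ * Real.sqrt (2 * δ) := by
  have H := isTwiceAC_bump he hδ x₀ β
  set f : ℝ → ℂ := fun x =>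
    β * ((δ * ((1 - (1 - e * (x - x₀) / δ)) * max 0 (1 - e * (x - x₀) / δ) ^ 2) : ℝ) : ℂ) with hf
  set g : ℝ → ℂ := fun x => β * ((e * (max 0 (1 - e * (x - x₀) / δ) ^ 2 -
        2 * (1 - (1 - e * (x - x₀) / δ)) * max 0 (1 - e * (x - x₀) / δ)) : ℝ) : ℂ) with hg
  set h : ℝ → ℂ := fun x =>
    β * (((if 0 < 1 - e * (x - x₀) / δ then 2 - 6 * (1 - e * (x - x₀) / δ) else 0) / δ
        : ℝ) : ℂ) with hh
  have hB0 : 0 ≤ B := (norm_nonneg _).trans hB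
  have hfar : ∀ x, δ ≤ e * (x - x₀) → 1 - e * (x - x₀) / δ ≤ 0 := fun x hx => by
    rw [sub_nonpos, le_div_iff₀ hδ]; linarith
  have habs : ∀ x ∈ s, δ < |x - x₀| → δ ≤ e * (x - x₀) := by
    intro x hx hd
    have h1 : |e| = 1 := by
      have : |e| ^ 2 = 1 ^ 2 := by rw [sq_abs, he, one_pow]
      exact (pow_left_inj₀ (abs_nonneg e) zero_le_one two_ne_zero).1 this
    rw [← abs_of_nonneg (hs x hx), abs_mul, h1, one_mul]
    exact hd.le
  have hle1 : ∀ x ∈ s, 1 - e * (x - x₀) / δ ≤ 1 := fun x hx => by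
    have := div_nonneg (hs x hx) hδ.le
    linarith
  have hfz : ∀ x, δ ≤ e * (x - x₀) → f x = 0 := fun x hx => by
    simp [hf, max_eq_left (hfar x hx)]
  have hhz : ∀ x, δ ≤ e * (x - x₀) → h x = 0 := fun x hx => by
    simp only [hh]
    rw [if_neg (hfar x hx).not_gt]
    simp
  obtain ⟨hm1, hn1⟩ := memLp_of_bound_of_support (f := f) (x₀ := x₀) (C := B * δ) hδ hsm
    H.continuous.aestronglyMeasurable (by positivity) (fun x hx => by
      simp only [hf]
      rw [norm_mul, Complex.norm_real]
      refine mul_le_mul hB ?_ (norm_nonneg _) hB0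
      rw [Real.norm_eq_abs, abs_mul, abs_of_pos hδ]
      refine mul_le_of_le_one_right hδ.le ?_
      have h1 := hle1 x hx
      generalize 1 - e * (x - x₀) / δ = y at h1
      rcases le_total y 0 with h0 | h0
      · simp [max_eq_left h0]
      · rw [max_eq_right h0, abs_of_nonneg (mul_nonneg (by linarith) (by positivity))]
        nlinarith [mul_nonneg h0 h0]) (fun x hx hd => hfz x (habs x hx hd))
  obtain ⟨hm2, hn2⟩ := memLp_of_bound_of_support (f := h) (x₀ := x₀) (C := 4 * B / δ) hδ hsm
    (by
      refine Measurable.aestronglyMeasurable ?_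
      refine measurable_const.mul (Complex.measurable_ofReal.comp (Measurable.div_const ?_ _))
      exact Measurable.ite (measurableSet_lt measurable_const (by fun_prop)) (by fun_prop)
        measurable_const) (by positivity) (fun x hx => by
      simp only [hh]
      rw [norm_mul, Complex.norm_real, show 4 * B / δ = B * (4 / δ) by ring]
      refine mul_le_mul hB ?_ (norm_nonneg _) hB0
      rw [norm_div, Real.norm_of_nonneg hδ.le, Real.norm_eq_abs]
      gcongr
      have h1 := hle1 x hx
      generalize 1 - e * (x - x₀) / δ = y at h1
      split_ifs with h0
      · rw [abs_le]
        constructor <;> linarith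
      · simp) (fun x hx hd => hhz x (habs x hx hd))
  refine ⟨_, _, f, g, H.isRep hm1 hm2, by simp [hf], by simp [hg, mul_comm], fun x hx =>
    ⟨hfz x hx, by simp [hg, max_eq_left (hfar x hx)]⟩, hn1, hn2⟩

variable {V I E : Type*} {G : MetricGraph V I E}

/-- On an external edge every derivative at the end point is attained by a function that vanishes
there, with norm and energy bounded by `1`. -/
theorem exists_bump_ext (e : E) (β : ℂ) :
    ∃ (ψ χ : G.EdgeSpace (Sum.inl e : E ⊕ I)) (f g : ℝ → ℂ), IsRep ψ χ f g ∧ f 0 = 0 ∧ g 0 = β ∧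
      ‖ψ‖ ≤ 1 ∧ ‖(inner ℂ ψ χ : ℂ)‖ ≤ 1 := by
  set B := ‖β‖ with hB
  have hB0 : 0 ≤ B := norm_nonneg _
  set δ := 1 / (2 + B + 8 * B ^ 2) with hδ
  have hδ0 : 0 < δ := by positivity
  have hδD : δ * (2 + B + 8 * B ^ 2) = 1 := by rw [hδ]; field_simp
  obtain ⟨ψ, χ, f, g, h, hf, hg, -, h1, h2⟩ := exists_isRep_bump (e := 1) (x₀ := 0)
    (s := G.interval (Sum.inl e : E ⊕ I)) (by norm_num) hδ0 hB.ge (measurableSet_interval _)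
    (fun x hx => by have : (0 : ℝ) ≤ x := hx; simpa using this)
  have hsq : Real.sqrt (2 * δ) ^ 2 = 2 * δ := Real.sq_sqrt (by positivity)
  have hs0 : 0 ≤ Real.sqrt (2 * δ) := Real.sqrt_nonneg _
  have hs1 : Real.sqrt (2 * δ) ≤ 1 := by
    rw [Real.sqrt_le_one]
    nlinarith [mul_nonneg hδ0.le hB0, mul_nonneg hδ0.le (sq_nonneg B)]
  refine ⟨ψ, χ, f, g, h, hf, by simpa using hg, h1.trans ?_, ?_⟩
  · refine mul_le_one₀ ?_ hs0 hs1
    nlinarith [mul_nonneg hδ0.le (sq_nonneg B)]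
  · calc ‖(inner ℂ ψ χ : ℂ)‖ ≤ ‖ψ‖ * ‖χ‖ := norm_inner_le_norm _ _
      _ ≤ (B * δ * Real.sqrt (2 * δ)) * (4 * B / δ * Real.sqrt (2 * δ)) := by gcongr
      _ = 4 * B ^ 2 * Real.sqrt (2 * δ) ^ 2 := by field_simp
      _ ≤ 1 := by
        rw [hsq]
        nlinarith [mul_nonneg hδ0.le hB0]

/-- On an internal edge every pair of inward derivatives at the end points is attained by a function
that vanishes there, with norm and energy bounded by `1`. -/
theorem exists_bump_int (i : I) (β₁ β₂ : ℂ) :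
    ∃ (ψ χ : G.EdgeSpace (Sum.inr i : E ⊕ I)) (f g : ℝ → ℂ), IsRep ψ χ f g ∧ f 0 = 0 ∧
      f (G.len i) = 0 ∧ g 0 = β₁ ∧ -g (G.len i) = β₂ ∧
      ‖ψ‖ ≤ 1 ∧ ‖(inner ℂ ψ χ : ℂ)‖ ≤ 1 := by
  have ha := G.len_pos i
  set a := G.len i
  set B := max ‖β₁‖ ‖β₂‖ with hB
  have hB0 : 0 ≤ B := (norm_nonneg _).trans (le_max_left _ _)
  set δ := min a (1 / (2 + 2 * B + 32 * B ^ 2)) with hδ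
  have hδ0 : 0 < δ := lt_min ha (by positivity)
  have hδa : δ ≤ a := min_le_left _ _
  have hδD : δ * (2 + 2 * B + 32 * B ^ 2) ≤ 1 := by
    rw [← le_div_iff₀ (by positivity)]
    exact min_le_right _ _
  -- `δ ≤ a` makes each of the two functions vanish to first order at the opposite end
  obtain ⟨ψ, χ, f, g, h, hf, hg, hz, h1, h2⟩ := exists_isRep_bump (e := 1) (x₀ := 0)
    (s := G.interval (Sum.inr i : E ⊕ I)) (by norm_num) hδ0 (le_max_left ‖β₁‖ ‖β₂‖)
    (measurableSet_interval _) (fun x hx => by simpa using hx.1)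
  obtain ⟨ψ', χ', f', g', h', hf', hg', hz', h1', h2'⟩ := exists_isRep_bump (e := -1) (x₀ := a)
    (s := G.interval (Sum.inr i : E ⊕ I)) (by norm_num) hδ0 (le_max_right ‖β₁‖ ‖β₂‖)
    (measurableSet_interval _) (fun x hx => by have := hx.2; simpa using this)
  obtain ⟨hza, hzga⟩ := hz a (by simpa using hδa)
  obtain ⟨hz0, hzg0⟩ := hz' 0 (by simpa using hδa)
  have hsq : Real.sqrt (2 * δ) ^ 2 = 2 * δ := Real.sq_sqrt (by positivity)
  have hs0 : 0 ≤ Real.sqrt (2 * δ) := Real.sqrt_nonneg _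
  have hs1 : Real.sqrt (2 * δ) ≤ 1 := by
    rw [Real.sqrt_le_one]
    nlinarith [mul_nonneg hδ0.le hB0, mul_nonneg hδ0.le (sq_nonneg B)]
  have hn : ‖ψ + ψ'‖ ≤ 2 * B * δ * Real.sqrt (2 * δ) :=
    (norm_add_le _ _).trans ((add_le_add h1 h1').trans (le_of_eq (by ring)))
  have hn' : ‖χ + χ'‖ ≤ 8 * B / δ * Real.sqrt (2 * δ) :=
    (norm_add_le _ _).trans ((add_le_add h2 h2').trans (le_of_eq (by ring)))
  refine ⟨ψ + ψ', χ + χ', f + f', g + g', h.add h', ?_, ?_, ?_, ?_, hn.trans ?_, ?_⟩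
  · simp [hf, hz0]
  · simp [hf', hza]
  · simp [hg, hzg0]
  · simp [hg', hzga]
  · refine mul_le_one₀ ?_ hs0 hs1
    nlinarith [mul_nonneg hδ0.le (sq_nonneg B)]
  · calc ‖(inner ℂ (ψ + ψ') (χ + χ') : ℂ)‖ ≤ ‖ψ + ψ'‖ * ‖χ + χ'‖ := norm_inner_le_norm _ _
      _ ≤ (2 * B * δ * Real.sqrt (2 * δ)) * (8 * B / δ * Real.sqrt (2 * δ)) := by gcongr
      _ = 16 * B ^ 2 * Real.sqrt (2 * δ) ^ 2 := by field_simp; ring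
      _ ≤ 1 := by
        rw [hsq]
        nlinarith [mul_nonneg hδ0.le hB0]

/-- A solution of `f'' = κ² f` in `L²(s)`. -/
theorem IsTwiceAC.exists_isRep_eigen {f g : ℝ → ℂ} {s : Set ℝ} {κ : ℝ}
    (H : IsTwiceAC f g (fun x => κ ^ 2 * f x)) (hf : MemLp f 2 (volume.restrict s)) :
    ∃ ψ : Lp ℂ 2 (volume.restrict s), IsRep ψ ((κ ^ 2 : ℂ) • ψ) f g :=
  ⟨hf.toLp f, H.isRep hf (hf.const_smul ((κ : ℂ) ^ 2))⟩

theorem exists_homogeneous_ext (e : E) {κ : ℝ} (hκ : 0 < κ) (c : ℂ) :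
    ∃ (ψ : G.EdgeSpace (Sum.inl e : E ⊕ I)) (f g : ℝ → ℂ), IsRep ψ ((κ ^ 2 : ℂ) • ψ) f g ∧
      f 0 = c := by
  obtain ⟨ψ, hψ⟩ := (isTwiceAC_exp κ 0 c).exists_isRep_eigen
    (s := G.interval (Sum.inl e : E ⊕ I)) (by
      simp only [interval, ← restrict_Ioi_eq_restrict_Ici, zero_mul, zero_add]
      exact (memLp_cexp_Ioi hκ 0).const_mul c)
  exact ⟨ψ, _, _, hψ, by simp⟩

theorem exists_homogeneous_int (i : I) {κ : ℝ} (hκ : 0 < κ) (c₁ c₂ : ℂ) :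
    ∃ (ψ : G.EdgeSpace (Sum.inr i : E ⊕ I)) (f g : ℝ → ℂ), IsRep ψ ((κ ^ 2 : ℂ) • ψ) f g ∧
      f 0 = c₁ ∧ f (G.len i) = c₂ := by
  have ha := G.len_pos i
  set a := G.len i
  set p := Complex.exp (κ * a) with hp
  set q := Complex.exp (-κ * a) with hq
  have hpq : p - q ≠ 0 := by
    intro h0
    have h1 := congrArg norm (sub_eq_zero.1 h0)
    have h2 := norm_cexp_ofReal_mul (-κ) a
    push_cast at h2
    rw [hp, hq, norm_cexp_ofReal_mul, h2, Real.exp_eq_exp] at h1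
    nlinarith [mul_pos hκ ha]
  -- `α` solves `α * p + (c₁ - α) * q = c₂`
  set α := (c₂ - c₁ * q) / (p - q) with hα
  obtain ⟨ψ, hψ⟩ := (isTwiceAC_exp κ α (c₁ - α)).exists_isRep_eigen
    (s := G.interval (Sum.inr i : E ⊕ I)) (memLp_of_continuous_Icc (by fun_prop) _ _)
  refine ⟨ψ, _, _, hψ, by simp, ?_⟩
  simp only [← hp, ← hq]
  rw [hα]
  field_simp
  ring

/-- The equation `-ψ'' + κ² ψ = φ` is solvable on every edge, by extension of `φ` by zero to the
line. -/
theorem exists_resolvent_edge (j : E ⊕ I) {κ : ℝ} (hκ : 0 < κ) (φ : G.EdgeSpace j) :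
    ∃ (ψ : G.EdgeSpace j) (f g : ℝ → ℂ), IsRep ψ ((κ ^ 2 : ℂ) • ψ - φ) f g := by
  have hsm := measurableSet_interval (G := G) j
  have hm : StronglyMeasurable ((G.interval j).indicator φ) :=
    (Lp.stronglyMeasurable φ).indicator hsm
  obtain ⟨u, g, H, hu⟩ := exists_resolvent hκ hm
    ((memLp_indicator_iff_restrict hsm).2 (Lp.memLp φ))
  have hφ : MemLp ((G.interval j).indicator φ) 2 (volume.restrict (G.interval j)) :=
    ((memLp_indicator_iff_restrict hsm).2 (Lp.memLp φ)).restrict _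
  have h1 : MemLp (fun x => (κ : ℂ) ^ 2 * u x) 2 (volume.restrict (G.interval j)) :=
    (hu.restrict _).const_mul _
  have hrep := H.isRep (hu.restrict _) (h1.sub hφ)
  refine ⟨(hu.restrict _).toLp u, u, g, ?_⟩
  convert hrep using 1
  refine Lp.ext ?_
  filter_upwards [(h1.sub hφ).coeFn_toLp, (hu.restrict (G.interval j)).coeFn_toLp,
    Lp.coeFn_sub ((κ ^ 2 : ℂ) • (hu.restrict (G.interval j)).toLp u) φ,
    Lp.coeFn_smul (κ ^ 2 : ℂ) ((hu.restrict (G.interval j)).toLp u), ae_restrict_mem hsm]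
    with x e1 e2 e3 e4 hx
  rw [e3, Pi.sub_apply, e4, Pi.smul_apply, e2]
  refine Eq.trans ?_ e1.symm
  simp [indicator_of_mem hx]

variable [Fintype I] [Fintype E]

/-! ### The maximal operator on the graph -/

/-- The maximal operator `-Δ` as a linear map on the maximal domain. -/
noncomputable def maxOp (G : MetricGraph V I E) : G.maxDomain →ₗ[ℂ] G.HilbertSpace :=
  G.negLaplacianMax.toFun

theorem maxOp_apply (u : G.maxDomain) (j : E ⊕ I) :
    G.maxOp u j = -secondDeriv (G.component j u) := rfl

theorem bdValue_inl (u : G.maxDomain) (e : E) :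
    G.bdValue u (Sum.inl e) = rep (G.component (Sum.inl e) u) 0 := rfl

theorem bdValue_inr_inl (u : G.maxDomain) (i : I) :
    G.bdValue u (Sum.inr (Sum.inl i)) = rep (G.component (Sum.inr i) u) 0 := rfl

theorem bdValue_inr_inr (u : G.maxDomain) (i : I) :
    G.bdValue u (Sum.inr (Sum.inr i)) = rep (G.component (Sum.inr i) u) (G.len i) := rfl

theorem bdDeriv_inl (u : G.maxDomain) (e : E) :
    G.bdDeriv u (Sum.inl e) = repDeriv (G.component (Sum.inl e) u) 0 := rfl

theorem bdDeriv_inr_inl (u : G.maxDomain) (i : I) :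
    G.bdDeriv u (Sum.inr (Sum.inl i)) = repDeriv (G.component (Sum.inr i) u) 0 := rfl

theorem bdDeriv_inr_inr (u : G.maxDomain) (i : I) :
    G.bdDeriv u (Sum.inr (Sum.inr i)) = -repDeriv (G.component (Sum.inr i) u) (G.len i) := rfl

/-- Functions given on each edge define an element of the maximal domain. -/
theorem exists_maxDomain {ψ χ : ∀ j : E ⊕ I, G.EdgeSpace j} {f g : E ⊕ I → ℝ → ℂ}
    (h : ∀ j, IsRep (ψ j) (χ j) (f j) (g j)) :
    ∃ u : G.maxDomain, (∀ j, (u : G.HilbertSpace) j = ψ j) ∧ (∀ j, G.maxOp u j = -χ j) ∧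
      G.bdValue u = WithLp.toLp 2 (Sum.elim (fun e => f (Sum.inl e) 0)
        (Sum.elim (fun i => f (Sum.inr i) 0) fun i => f (Sum.inr i) (G.len i))) ∧
      G.bdDeriv u = WithLp.toLp 2 (Sum.elim (fun e => g (Sum.inl e) 0)
        (Sum.elim (fun i => g (Sum.inr i) 0) fun i => -g (Sum.inr i) (G.len i))) := by
  let u : G.maxDomain := ⟨WithLp.toLp 2 ψ, fun j => ⟨χ j, f j, g j, h j⟩⟩
  have hu : ∀ j, IsRep (ψ j) (secondDeriv (G.component j u)) (rep (G.component j u))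
    (repDeriv (G.component j u)) := fun j => isRep (G.component j u)
  refine ⟨u, fun j => rfl, fun j => ?_, ?_, ?_⟩
  · rw [maxOp_apply, (hu j).eq_deriv_two (h j)]
  · ext (e | i | i)
    · exact (hu _).eqOn (h _) (zero_mem_interval _)
    · exact (hu _).eqOn (h _) (zero_mem_interval _)
    · exact (hu _).eqOn (h _) (len_mem_interval i)
  · ext (e | i | i)
    · exact (hu _).eqOn_deriv (h _) (zero_mem_interval _)
    · exact (hu _).eqOn_deriv (h _) (zero_mem_interval _)
    · exact congrArg Neg.neg ((hu _).eqOn_deriv (h _) (len_mem_interval i))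

/-- Green's formula and the trace estimate on the graph: `⟨u, -Δ u⟩` and the boundary form differ by
a real number, which dominates any multiple of the squared norm of the boundary values up to a
multiple of `‖u‖ ^ 2`. -/
theorem exists_green {c : ℝ} (hc : 0 ≤ c) : ∃ C : ℝ, ∀ u : G.maxDomain,
    (inner ℂ (u : G.HilbertSpace) (G.maxOp u)).im = (inner ℂ (G.bdValue u) (G.bdDeriv u)).im ∧
    c * ‖G.bdValue u‖ ^ 2 ≤ (inner ℂ (u : G.HilbertSpace) (G.maxOp u)).re -
      (inner ℂ (G.bdValue u) (G.bdDeriv u)).re + C * ‖(u : G.HilbertSpace)‖ ^ 2 := by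
  set C := c ^ 2 + ∑ i, 2 * c / G.len i with hC
  have hCi : ∀ i, 2 * c / G.len i + c ^ 2 ≤ C := fun i => by
    have := Finset.single_le_sum (f := fun i => 2 * c / G.len i)
      (fun i _ => div_nonneg (by positivity) (G.len_pos i).le) (Finset.mem_univ i)
    linarith
  have hCe : c ^ 2 ≤ C := by
    have := Finset.sum_nonneg (s := Finset.univ) (f := fun i => 2 * c / G.len i)
      (fun i _ => div_nonneg (by positivity) (G.len_pos i).le)
    linarith
  refine ⟨C, fun u => ?_⟩
  set ψ := fun j => (u : G.HilbertSpace) j with hψ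
  set χ := fun j => secondDeriv (G.component j u) with hχ
  set f := fun j => rep (G.component j u) with hf
  set g := fun j => repDeriv (G.component j u) with hg
  have hrep : ∀ j, IsRep (ψ j) (χ j) (f j) (g j) := fun j => isRep (G.component j u)
  have hext : ∀ e : E, (inner ℂ (ψ (Sum.inl e)) (χ (Sum.inl e)) +
      (starRingEnd ℂ) (f (Sum.inl e) 0) * g (Sum.inl e) 0).im = 0 ∧
      c * ‖f (Sum.inl e) 0‖ ^ 2 ≤ -(inner ℂ (ψ (Sum.inl e)) (χ (Sum.inl e)) +
      (starRingEnd ℂ) (f (Sum.inl e) 0) * g (Sum.inl e) 0).re + c ^ 2 * ‖ψ (Sum.inl e)‖ ^ 2 :=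
    fun e => (hrep (Sum.inl e)).green_Ici hc
  have hint : ∀ i : I, (inner ℂ (ψ (Sum.inr i)) (χ (Sum.inr i)) +
      (starRingEnd ℂ) (f (Sum.inr i) 0) * g (Sum.inr i) 0 -
      (starRingEnd ℂ) (f (Sum.inr i) (G.len i)) * g (Sum.inr i) (G.len i)).im = 0 ∧
      c * ‖f (Sum.inr i) 0‖ ^ 2 + c * ‖f (Sum.inr i) (G.len i)‖ ^ 2 ≤
      -(inner ℂ (ψ (Sum.inr i)) (χ (Sum.inr i)) +
      (starRingEnd ℂ) (f (Sum.inr i) 0) * g (Sum.inr i) 0 -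
      (starRingEnd ℂ) (f (Sum.inr i) (G.len i)) * g (Sum.inr i) (G.len i)).re +
      (2 * c / G.len i + c ^ 2) * ‖ψ (Sum.inr i)‖ ^ 2 := by
    intro i
    have ha := G.len_pos i
    -- for this slope, `φ x = c - m * x` decreases from `c` to `-c` on the edge
    have h := (hrep (Sum.inr i)).green_Icc (c := c) (m := 2 * c / G.len i) ha.le Subset.rfl
      (by positivity) (le_of_eq (by field_simp))
    have e : inner ℂ (ψ (Sum.inr i)) (χ (Sum.inr i)) =
        ∫ x in 0..G.len i, (starRingEnd ℂ) (f (Sum.inr i) x) * χ (Sum.inr i) x := by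
      rw [(hrep (Sum.inr i)).inner_eq, intervalIntegral.integral_of_le ha.le]
      exact integral_Icc_eq_integral_Ioc
    rw [← e, show c - 2 * c / G.len i * G.len i = -c by field_simp; ring] at h
    refine ⟨h.1, ?_⟩
    have := h.2
    linarith
  have key : inner ℂ (u : G.HilbertSpace) (G.maxOp u) - inner ℂ (G.bdValue u) (G.bdDeriv u) =
      -((∑ e : E, (inner ℂ (ψ (Sum.inl e)) (χ (Sum.inl e)) +
        (starRingEnd ℂ) (f (Sum.inl e) 0) * g (Sum.inl e) 0)) +
      ∑ i : I, (inner ℂ (ψ (Sum.inr i)) (χ (Sum.inr i)) +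
        (starRingEnd ℂ) (f (Sum.inr i) 0) * g (Sum.inr i) 0 -
        (starRingEnd ℂ) (f (Sum.inr i) (G.len i)) * g (Sum.inr i) (G.len i))) := by
    rw [PiLp.inner_apply, PiLp.inner_apply]
    simp only [Fintype.sum_sum_type, maxOp_apply, bdValue_inl, bdValue_inr_inl, bdValue_inr_inr,
      bdDeriv_inl, bdDeriv_inr_inl, bdDeriv_inr_inr, inner_neg_right, RCLike.inner_apply,
      neg_mul, Finset.sum_add_distrib, Finset.sum_sub_distrib, Finset.sum_neg_distrib]
    simp only [hψ, hχ, hf, hg, mul_comm]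
    ring
  have hbd : ‖G.bdValue u‖ ^ 2 = ∑ e : E, ‖f (Sum.inl e) 0‖ ^ 2 +
      ∑ i : I, (‖f (Sum.inr i) 0‖ ^ 2 + ‖f (Sum.inr i) (G.len i)‖ ^ 2) := by
    rw [PiLp.norm_sq_eq_of_L2]
    simp only [Fintype.sum_sum_type, Finset.sum_add_distrib]
    rfl
  have hnorm : ‖(u : G.HilbertSpace)‖ ^ 2 = ∑ e : E, ‖ψ (Sum.inl e)‖ ^ 2 +
      ∑ i : I, ‖ψ (Sum.inr i)‖ ^ 2 := by
    rw [PiLp.norm_sq_eq_of_L2]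
    simp only [Fintype.sum_sum_type]
    rfl
  have kim := congrArg Complex.im key
  have kre := congrArg Complex.re key
  rw [Complex.sub_im, Complex.neg_im, Complex.add_im, Complex.im_sum, Complex.im_sum] at kim
  simp only [fun e => (hext e).1, fun i => (hint i).1, Finset.sum_const_zero, add_zero,
    neg_zero] at kim
  rw [Complex.sub_re, Complex.neg_re, Complex.add_re, Complex.re_sum, Complex.re_sum] at kre
  constructor
  · linarith
  rw [kre, hbd, hnorm, mul_add, mul_add, neg_add, Finset.mul_sum, Finset.mul_sum, Finset.mul_sum,
    Finset.mul_sum, ← Finset.sum_neg_distrib, ← Finset.sum_neg_distrib, add_add_add_comm,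
    ← Finset.sum_add_distrib, ← Finset.sum_add_distrib]
  refine add_le_add (Finset.sum_le_sum fun e _ => ?_) (Finset.sum_le_sum fun i _ => ?_)
  · refine (hext e).2.trans ?_
    gcongr
  · rw [mul_add]
    refine (hint i).2.trans ?_
    gcongr
    exact hCi i

/-- Every vector of boundary derivatives is attained by functions that vanish at the boundary, with
norm and energy bounded independently of the vector. -/
theorem exists_bdDeriv_eq (y : BdSpace I E) : ∃ w : G.maxDomain, G.bdValue w = 0 ∧
    G.bdDeriv w = y ∧ ‖(w : G.HilbertSpace)‖ ^ 2 ≤ Fintype.card (E ⊕ I) ∧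
    ‖(inner ℂ (w : G.HilbertSpace) (G.maxOp w) : ℂ)‖ ≤ Fintype.card (E ⊕ I) := by
  choose ψe χe fe ge hre hfe hge hne hie using fun e : E =>
    exists_bump_ext (G := G) e (y (Sum.inl e))
  choose ψi χi fi gi hri hfi hfi' hgi hgi' hni hii using fun i : I =>
    exists_bump_int (G := G) i (y (Sum.inr (Sum.inl i))) (y (Sum.inr (Sum.inr i)))
  obtain ⟨u, hu, hTu, hv, hd⟩ := exists_maxDomain (G := G) (ψ := Sum.rec ψe ψi)
    (χ := Sum.rec χe χi) (f := Sum.elim fe fi) (g := Sum.elim ge gi) (by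
      rintro (e | i)
      · exact hre e
      · exact hri i)
  refine ⟨u, ?_, ?_, ?_, ?_⟩
  · rw [hv]
    ext (e | i | i)
    · exact hfe e
    · exact hfi i
    · exact hfi' i
  · rw [hd]
    ext (e | i | i)
    · exact hge e
    · exact hgi i
    · exact hgi' i
  · rw [PiLp.norm_sq_eq_of_L2, ← nsmul_one, ← Finset.card_univ, ← Finset.sum_const]
    refine Finset.sum_le_sum fun j _ => ?_
    rw [hu]
    refine pow_le_one₀ (norm_nonneg _) ?_
    rcases j with e | i
    · exact hne e
    · exact hni i
  · rw [PiLp.inner_apply, ← nsmul_one, ← Finset.card_univ, ← Finset.sum_const]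
    refine (norm_sum_le _ _).trans (Finset.sum_le_sum fun j _ => ?_)
    rw [hu, hTu, inner_neg_right, norm_neg]
    rcases j with e | i
    · exact hie e
    · exact hii i

/-- The Dirichlet problem for `-Δ u + κ² u = 0` is solvable. -/
theorem exists_homogeneous {κ : ℝ} (hκ : 0 < κ) (x : BdSpace I E) :
    ∃ u : G.maxDomain, G.bdValue u = x ∧ G.maxOp u + (κ ^ 2 : ℂ) • (u : G.HilbertSpace) = 0 := by
  choose ψe fe ge hre hfe using fun e : E => exists_homogeneous_ext (G := G) e hκ (x (Sum.inl e))
  choose ψi fi gi hri hfi hfi' using fun i : I =>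
    exists_homogeneous_int (G := G) i hκ (x (Sum.inr (Sum.inl i))) (x (Sum.inr (Sum.inr i)))
  obtain ⟨u, hu, hTu, hv, hd⟩ := exists_maxDomain (G := G) (ψ := Sum.rec ψe ψi)
    (χ := fun j => (κ ^ 2 : ℂ) • (Sum.rec ψe ψi : ∀ j, G.EdgeSpace j) j)
    (f := Sum.elim fe fi) (g := Sum.elim ge gi) (by
      rintro (e | i)
      · exact hre e
      · exact hri i)
  refine ⟨u, ?_, ?_⟩
  · rw [hv]
    ext (e | i | i)
    · exact hfe e
    · exact hfi i
    · exact hfi' i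
  · ext1 j
    rw [PiLp.add_apply, PiLp.smul_apply, hu, hTu, neg_add_cancel, PiLp.zero_apply]

/-- The maximal operator satisfies `Ran (-Δ + κ²) = H`. -/
theorem exists_maxOp_add_eq {κ : ℝ} (hκ : 0 < κ) (φ : G.HilbertSpace) :
    ∃ u : G.maxDomain, G.maxOp u + (κ ^ 2 : ℂ) • (u : G.HilbertSpace) = φ := by
  choose ψ f g hr using fun j : E ⊕ I => exists_resolvent_edge j hκ (φ j)
  obtain ⟨u, hu, hTu, -, -⟩ := exists_maxDomain hr
  refine ⟨u, ?_⟩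
  ext1 j
  rw [PiLp.add_apply, PiLp.smul_apply, hu, hTu, neg_sub, sub_add_cancel]

end MetricGraph

/-! ### A criterion for quasi-m-accretivity -/

section Accretive

variable {H : Type*} [NormedAddCommGroup H] [InnerProductSpace ℂ H]

/-- For `l > C` this makes `T + l` injective with bounded inverse. -/
theorem norm_le_norm_add_smul_of_accretive {T : H →ₗ.[ℂ] H} {C : ℝ}
    (hT : ∀ u : T.domain, 0 ≤ (inner ℂ (u : H) (T u)).re + C * ‖(u : H)‖ ^ 2) (l : ℝ)
    (u : T.domain) : (l - C) * ‖(u : H)‖ ≤ ‖T u + (l : ℂ) • (u : H)‖ := by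
  rcases (norm_nonneg (u : H)).eq_or_lt with h0 | h0
  · rw [← h0, mul_zero]
    exact norm_nonneg _
  refine le_of_mul_le_mul_left ?_ h0
  have h1 : (inner ℂ (u : H) (T u + (l : ℂ) • (u : H))).re =
      (inner ℂ (u : H) (T u)).re + l * ‖(u : H)‖ ^ 2 := by
    rw [inner_add_right, inner_smul_right, Complex.add_re, Complex.re_ofReal_mul]
    congr 2
    exact inner_self_eq_norm_sq (𝕜 := ℂ) (u : H)
  have h2 := (Complex.re_le_norm _).trans (norm_inner_le_norm (𝕜 := ℂ) (u : H)
    (T u + (l : ℂ) • (u : H)))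
  have := hT u
  nlinarith

/-- A quasi-accretive operator `T` for which `T + l` is surjective for arbitrarily large `l` is
quasi-m-accretive: the bounded inverse of `T + l` makes `T` closed, and an extension of `T` which is
injective after adding `l` cannot be proper. -/
theorem IsQuasiAccretive.isQuasiMAccretive {T : H →ₗ.[ℂ] H} (hT : IsQuasiAccretive T)
    (hs : ∀ C : ℝ, ∃ l : ℝ, C < l ∧ ∀ φ : H, ∃ u : T.domain, T u + (l : ℂ) • (u : H) = φ) :
    IsQuasiMAccretive T := by
  refine ⟨?_, hT, ?_⟩
  · obtain ⟨C, hC⟩ := hT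
    obtain ⟨l, hl, hsurj⟩ := hs C
    -- The limit of the graph points is identified through the preimage `w` under `T + l`.
    refine IsSeqClosed.isClosed fun p x hp hx => ?_
    choose u hu1 hu2 using fun n => (LinearPMap.mem_graph_iff T).1 (hp n)
    obtain ⟨w, hw⟩ := hsurj (x.2 + (l : ℂ) • x.1)
    have hlim1 : Tendsto (fun n => (p n).1) atTop (𝓝 x.1) := (continuous_fst.tendsto x).comp hx
    have hlim2 : Tendsto (fun n => (p n).2) atTop (𝓝 x.2) := (continuous_snd.tendsto x).comp hx
    have hle : ∀ n, ‖(p n).1 - w‖ ≤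
        (l - C)⁻¹ * ‖(p n).2 + (l : ℂ) • (p n).1 - (x.2 + (l : ℂ) • x.1)‖ := by
      intro n
      have h := norm_le_norm_add_smul_of_accretive hC l (u n - w)
      rw [LinearPMap.map_sub, Submodule.coe_sub, hu1, hu2] at h
      have e : (p n).2 - T w + (l : ℂ) • ((p n).1 - (w : H)) =
          (p n).2 + (l : ℂ) • (p n).1 - (x.2 + (l : ℂ) • x.1) := by
        rw [← hw, smul_sub]
        abel
      rw [e] at h
      rwa [inv_mul_eq_div, le_div_iff₀ (sub_pos.2 hl), mul_comm]
    have hlim3 : Tendsto (fun n => (p n).1) atTop (𝓝 (w : H)) := by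
      rw [tendsto_iff_norm_sub_tendsto_zero]
      refine squeeze_zero (fun n => norm_nonneg _) hle ?_
      have := ((hlim2.add (hlim1.const_smul (l : ℂ))).sub_const (x.2 + (l : ℂ) • x.1)).norm
      simpa using this.const_mul (l - C)⁻¹
    have hxw : x.1 = w := tendsto_nhds_unique hlim1 hlim3
    refine (LinearPMap.mem_graph_iff T).2 ⟨w, hxw.symm, ?_⟩
    rw [hxw] at hw
    exact add_right_cancel hw
  · rintro S hTS ⟨C, hC⟩
    obtain ⟨l, hl, hsurj⟩ := hs C
    refine (LinearPMap.eq_of_le_of_domain_eq hTS (le_antisymm hTS.1 fun x hx => ?_)).symm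
    obtain ⟨w, hw⟩ := hsurj (S ⟨x, hx⟩ + (l : ℂ) • x)
    have hTw : T w = S ⟨w, hTS.1 w.2⟩ := hTS.2 rfl
    have h := norm_le_norm_add_smul_of_accretive hC l (⟨x, hx⟩ - ⟨w, hTS.1 w.2⟩)
    have e : S (⟨x, hx⟩ - ⟨w, hTS.1 w.2⟩) +
        (l : ℂ) • (((⟨x, hx⟩ - ⟨w, hTS.1 w.2⟩ : S.domain)) : H) = 0 := by
      rw [LinearPMap.map_sub, ← hTw, Submodule.coe_sub, smul_sub]
      rw [sub_add_sub_comm, ← hw, sub_self]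
    rw [e, norm_zero] at h
    have h0 : ‖x - (w : H)‖ = 0 := by
      refine le_antisymm ?_ (norm_nonneg _)
      by_contra! hpos
      exact absurd h (not_le.2 (mul_pos (sub_pos.2 hl) hpos))
    rw [sub_eq_zero.1 (norm_eq_zero.1 h0)]
    exact w.2

theorem IsSectorialOp.isQuasiAccretive {T : H →ₗ.[ℂ] H} (hT : IsSectorialOp T) :
    IsQuasiAccretive T := by
  obtain ⟨C, hC⟩ := hT
  exact ⟨C, fun u => (abs_nonneg _).trans (hC u)⟩

end Accretive

/-! ### Linear relations `A x + B y = 0` -/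

section LinearRelation

variable {K : Type*} [NormedAddCommGroup K] [InnerProductSpace ℂ K] [FiniteDimensional ℂ K]
  {A B : K →ₗ[ℂ] K}

/-- `Q A` vanishes on first components of the relation, `Q` being the projection onto
`(Ran B)^⊥`. -/
theorem starProjection_range_apply_eq_zero {x y : K} (h : A x + B y = 0) :
    (LinearMap.range B)ᗮ.starProjection (A x) = 0 := by
  rw [eq_neg_of_add_eq_zero_left h, map_neg, neg_eq_zero]
  exact (Submodule.starProjection_apply_eq_zero_iff _).2
    (Submodule.le_orthogonal_orthogonal _ (LinearMap.mem_range_self B y))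

/-- If `(A, B)` is surjective and `Q A P^⊥ = 0`, then `A x + B y = 0` implies `x ⟂ Ker B`: the map
`Q A` from `Ker B` to `(Ran B)^⊥` is surjective, hence injective by equality of dimensions. -/
theorem mem_ker_orthogonal_of_surjective
    (hs : Function.Surjective (LinearMap.coprod A B))
    (hQ : (LinearMap.range B)ᗮ.starProjection.toLinearMap ∘ₗ A ∘ₗ
        (LinearMap.id - (LinearMap.ker B).starProjection.toLinearMap) = 0)
    {x y : K} (h : A x + B y = 0) : x ∈ (LinearMap.ker B)ᗮ := by
  have hQP : ∀ z, (LinearMap.range B)ᗮ.starProjection (A z) =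
      (LinearMap.range B)ᗮ.starProjection (A ((LinearMap.ker B).starProjection z)) := by
    intro z
    have := LinearMap.congr_fun hQ z
    simp only [LinearMap.comp_apply, LinearMap.sub_apply, LinearMap.id_apply, map_sub,
      LinearMap.zero_apply, sub_eq_zero] at this
    exact this
  let S : LinearMap.ker B →ₗ[ℂ] ((LinearMap.range B)ᗮ : Submodule ℂ K) :=
    (LinearMap.range B)ᗮ.orthogonalProjectionOnto.toLinearMap ∘ₗ A ∘ₗ (LinearMap.ker B).subtype
  have hS : ∀ v, ((S v : (LinearMap.range B)ᗮ) : K) = (LinearMap.range B)ᗮ.starProjection (A v) :=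
    fun v => rfl
  have hSs : Function.Surjective S := by
    intro w
    obtain ⟨⟨x', y'⟩, hxy⟩ := hs w
    refine ⟨(LinearMap.ker B).orthogonalProjectionOnto x', Subtype.ext ?_⟩
    rw [hS]
    refine (hQP x').symm.trans ?_
    have h1 : A x' + B (y') = w := hxy
    have h2 : (LinearMap.range B)ᗮ.starProjection (B y') = 0 :=
      (Submodule.starProjection_apply_eq_zero_iff _).2
        (Submodule.le_orthogonal_orthogonal _ (LinearMap.mem_range_self B y'))
    have h3 := congrArg (LinearMap.range B)ᗮ.starProjection h1
    rw [map_add, h2, add_zero] at h3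
    rw [h3]
    exact Submodule.starProjection_eq_self_iff.2 w.2
  have hdim : Module.finrank ℂ (LinearMap.ker B) =
      Module.finrank ℂ ((LinearMap.range B)ᗮ : Submodule ℂ K) := by
    have h1 := LinearMap.finrank_range_add_finrank_ker B
    have h2 := Submodule.finrank_add_finrank_orthogonal (LinearMap.range B)
    omega
  have hSi := (LinearMap.injective_iff_surjective_of_finrank_eq_finrank hdim).2 hSs
  have h0 : S ((LinearMap.ker B).orthogonalProjectionOnto x) = 0 := by
    refine Subtype.ext ?_
    rw [hS]
    exact (hQP x).symm.trans (starProjection_range_apply_eq_zero h)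
  have h1 := (map_eq_zero_iff S hSi).1 h0
  exact (Submodule.starProjection_apply_eq_zero_iff _).1 (congrArg Subtype.val h1)

/-- If `A x + B y = 0` implies `x ⟂ Ker B`, then on this relation the component of `y` orthogonal
to `Ker B` is a linear function of `x`, so `⟨x, y⟩` is controlled by `‖x‖ ^ 2`. -/
theorem exists_norm_inner_le
    (h : ∀ x y, A x + B y = 0 → x ∈ (LinearMap.ker B)ᗮ) :
    ∃ c : ℝ, 0 ≤ c ∧ ∀ x y, A x + B y = 0 → ‖(inner ℂ x y : ℂ)‖ ≤ c * ‖x‖ ^ 2 := by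
  obtain ⟨L, hL⟩ :=
    (B ∘ₗ ((LinearMap.ker B)ᗮ : Submodule ℂ K).subtype).exists_leftInverse_of_injective
    (by
      rw [LinearMap.ker_eq_bot']
      intro v hv
      have h1 : (v : K) ∈ LinearMap.ker B := hv
      refine Subtype.ext (inner_self_eq_zero (𝕜 := ℂ) |>.1 ?_)
      exact (Submodule.mem_orthogonal _ _).1 v.2 v h1)
  let F : K →L[ℂ] K := LinearMap.toContinuousLinearMap
    (((LinearMap.ker B)ᗮ : Submodule ℂ K).subtype ∘ₗ L ∘ₗ A)
  refine ⟨‖F‖, norm_nonneg _, fun x y hxy => ?_⟩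
  set P := (LinearMap.ker B).starProjection y with hP
  have hPm : P ∈ LinearMap.ker B := Submodule.starProjection_apply_mem _ _
  have hy : y - P ∈ (LinearMap.ker B)ᗮ := Submodule.sub_starProjection_mem_orthogonal y
  have h1 : inner ℂ x y = inner ℂ x (y - P) := by
    rw [inner_sub_right, (Submodule.mem_orthogonal' _ _).1 (h x y hxy) P hPm, sub_zero]
  have h2 : y - P = -F x := by
    have h3 := LinearMap.congr_fun hL ⟨y - P, hy⟩
    have h4 : B (y - P) = -A x := by
      rw [map_sub, LinearMap.mem_ker.1 hPm, sub_zero]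
      exact eq_neg_of_add_eq_zero_right hxy
    have h5 := congrArg Subtype.val h3
    simp only [LinearMap.comp_apply, Submodule.subtype_apply, h4, map_neg] at h5
    exact h5.symm
  rw [h1, h2, inner_neg_right, norm_neg]
  calc ‖(inner ℂ x (F x) : ℂ)‖ ≤ ‖x‖ * ‖F x‖ := norm_inner_le_norm _ _
    _ ≤ ‖x‖ * (‖F‖ * ‖x‖) := by gcongr; exact F.le_opNorm x
    _ = ‖F‖ * ‖x‖ ^ 2 := by ring

/-- If `A x + B y = 0` implies `x ⟂ Ker B`, then `(A, B)` is surjective and `Q A P^⊥ = 0`: the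
relation has dimension at least `dim K`, and by assumption it has at most the dimension of
`(Ker B)^⊥ × Ker B`. -/
theorem surjective_of_forall_mem_ker_orthogonal
    (h : ∀ x y, A x + B y = 0 → x ∈ (LinearMap.ker B)ᗮ) :
    Function.Surjective (LinearMap.coprod A B) ∧
      (LinearMap.range B)ᗮ.starProjection.toLinearMap ∘ₗ A ∘ₗ
        (LinearMap.id - (LinearMap.ker B).starProjection.toLinearMap) = 0 := by
  set M := LinearMap.ker (LinearMap.coprod A B) with hM
  have hmem : ∀ p : M, A p.1.1 + B p.1.2 = 0 := fun p => p.2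
  let F : M →ₗ[ℂ] K := LinearMap.fst ℂ K K ∘ₗ M.subtype
  have hker : Module.finrank ℂ (LinearMap.ker F) ≤ Module.finrank ℂ (LinearMap.ker B) := by
    let J : LinearMap.ker F →ₗ[ℂ] LinearMap.ker B :=
      (LinearMap.snd ℂ K K ∘ₗ M.subtype ∘ₗ (LinearMap.ker F).subtype).codRestrict _ fun p => by
        have h1 : p.1.1.1 = 0 := p.2
        have h2 := hmem p.1
        rw [h1, map_zero, zero_add] at h2
        exact h2
    refine LinearMap.finrank_le_finrank_of_injective (f := J) ?_
    rintro ⟨⟨⟨x, y⟩, hp⟩, hx⟩ ⟨⟨⟨x', y'⟩, hp'⟩, hx'⟩ he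
    have e1 : x = 0 := hx
    have e2 : x' = 0 := hx'
    have e3 : y = y' := congrArg Subtype.val he
    subst e1 e2 e3
    rfl
  have hran : LinearMap.range F ≤ (LinearMap.ker B)ᗮ := by
    rintro _ ⟨p, rfl⟩
    exact h _ _ (hmem p)
  have d1 := LinearMap.finrank_range_add_finrank_ker F
  have d2 := LinearMap.finrank_range_add_finrank_ker (LinearMap.coprod A B)
  have d3 := Submodule.finrank_add_finrank_orthogonal (LinearMap.ker B)
  have d4 := Submodule.finrank_mono hran
  have d5 := Submodule.finrank_le (LinearMap.range (LinearMap.coprod A B))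
  rw [Module.finrank_prod, ← hM] at d2
  constructor
  · rw [← LinearMap.range_eq_top]
    refine Submodule.eq_top_of_finrank_eq ?_
    omega
  · have hran' := Submodule.eq_of_le_of_finrank_le hran (by omega)
    ext z
    have hz : z - (LinearMap.ker B).starProjection z ∈ LinearMap.range F := by
      rw [hran']
      exact Submodule.sub_starProjection_mem_orthogonal z
    obtain ⟨p, hp⟩ := hz
    have h1 := starProjection_range_apply_eq_zero (hmem p)
    have h2 : p.1.1 = z - (LinearMap.ker B).starProjection z := hp
    rw [h2] at h1
    exact h1

end LinearRelation

namespace MetricGraph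

variable {V I E : Type*} {G : MetricGraph V I E} [Fintype I] [Fintype E]
  {A B : BdSpace I E →ₗ[ℂ] BdSpace I E}

/-! ### The operator with boundary conditions -/

theorem mem_negLaplacian_domain {x : G.HilbertSpace} : x ∈ (G.negLaplacian A B).domain ↔
    ∃ u : G.maxDomain, (u : G.HilbertSpace) = x ∧ A (G.bdValue u) + B (G.bdDeriv u) = 0 := by
  rw [negLaplacian, LinearPMap.domRestrict_domain]
  constructor
  · rintro ⟨⟨u, hu, rfl⟩, -⟩
    exact ⟨u, rfl, hu⟩
  · rintro ⟨u, rfl, hu⟩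
    exact ⟨⟨u, hu, rfl⟩, u.2⟩

theorem negLaplacian_apply {x : (G.negLaplacian A B).domain} {u : G.maxDomain}
    (h : (u : G.HilbertSpace) = x) : G.negLaplacian A B x = G.maxOp u :=
  LinearPMap.domRestrict_apply (f := G.negLaplacianMax) (y := u) h.symm

/-- Statements about `-Δ(A, B)` reduce to statements about the maximal operator on functions that
satisfy the boundary conditions, whose boundary values are then available. -/
theorem forall_negLaplacian_domain {p : G.HilbertSpace → G.HilbertSpace → Prop} :
    (∀ x : (G.negLaplacian A B).domain, p x (G.negLaplacian A B x)) ↔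
      ∀ u : G.maxDomain, A (G.bdValue u) + B (G.bdDeriv u) = 0 → p u (G.maxOp u) := by
  constructor
  · intro h u hu
    have := h ⟨u, mem_negLaplacian_domain.2 ⟨u, rfl, hu⟩⟩
    rwa [negLaplacian_apply (u := u) rfl] at this
  · intro h x
    obtain ⟨u, hux, hu⟩ := mem_negLaplacian_domain.1 x.2
    rw [negLaplacian_apply hux, ← hux]
    exact h u hu

/-- The real part of Green's formula for two functions, by polarisation: the imaginary part of the
diagonal formula is applied to `u`, `v` and `u + i v`. -/
theorem green_re (u v : G.maxDomain) :
    (inner ℂ (u : G.HilbertSpace) (G.maxOp v)).re - (inner ℂ (G.bdValue u) (G.bdDeriv v)).re =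
    (inner ℂ (v : G.HilbertSpace) (G.maxOp u)).re - (inner ℂ (G.bdValue v) (G.bdDeriv u)).re := by
  obtain ⟨C, hC⟩ := exists_green (G := G) le_rfl
  have h1 := (hC u).1
  have h2 := (hC v).1
  have h3 := (hC (u + Complex.I • v)).1
  simp only [map_add, map_smul, Submodule.coe_add, Submodule.coe_smul, inner_add_left,
    inner_add_right, inner_smul_left, inner_smul_right, Complex.add_im, Complex.add_re,
    Complex.mul_im,
    Complex.mul_re, Complex.conj_I, Complex.neg_re, Complex.neg_im, Complex.I_re,
    Complex.I_im] at h3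
  linarith

theorem exists_bdValue_bdDeriv_eq (x y : BdSpace I E) :
    ∃ u : G.maxDomain, G.bdValue u = x ∧ G.bdDeriv u = y := by
  obtain ⟨h, hx, -⟩ := exists_homogeneous (G := G) zero_lt_one x
  obtain ⟨w, hw, hw', -⟩ := exists_bdDeriv_eq (G := G) (y - G.bdDeriv h)
  exact ⟨h + w, by rw [map_add, hx, hw, add_zero], by rw [map_add, hw']; abel⟩

/-- If `-Δ(A, B)` is quasi-accretive, then boundary values are orthogonal to `Ker B`. Adding a
function with boundary value zero, boundary derivative `y₀ ∈ Ker B` and bounded energy to a fixed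
`u` changes the quadratic form by `⟨x, y₀⟩` up to a bounded amount, for all multiples of `y₀`. -/
theorem mem_ker_orthogonal_of_isQuasiAccretive (hq : IsQuasiAccretive (G.negLaplacian A B))
    {x y : BdSpace I E} (h : A x + B y = 0) : x ∈ (LinearMap.ker B)ᗮ := by
  obtain ⟨C, hC⟩ := hq
  rw [forall_negLaplacian_domain (p := fun u v => 0 ≤ (inner ℂ u v).re + C * ‖u‖ ^ 2)] at hC
  obtain ⟨u, hux, huy⟩ := exists_bdValue_bdDeriv_eq (G := G) x y
  set n : ℝ := (Fintype.card (E ⊕ I) : ℝ) with hn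
  have hn0 : 0 ≤ n := Nat.cast_nonneg _
  -- `k` depends on `u` only, since the norm and the energy of `w` are bounded by `n`-dependent
  -- constants for every `y₀`
  obtain ⟨k, hk⟩ : ∃ k : ℝ, ∀ y₀ ∈ LinearMap.ker B, 0 ≤ k + (inner ℂ x y₀).re := by
    refine ⟨(inner ℂ (u : G.HilbertSpace) (G.maxOp u)).re +
      2 * ((n + 1) * ‖G.maxOp u‖) + n + |C| * (‖(u : G.HilbertSpace)‖ + (n + 1)) ^ 2, ?_⟩
    intro y₀ hy₀
    obtain ⟨w, hwv, hwd, hwn, hwi⟩ := exists_bdDeriv_eq (G := G) y₀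
    have hwn' : ‖(w : G.HilbertSpace)‖ ≤ n + 1 := by
      refine (abs_le_of_sq_le_sq' (hwn.trans ?_) (by linarith)).2
      nlinarith
    have h1 := hC (u + w) (by
      rw [map_add G.bdValue, map_add G.bdDeriv, hux, huy, hwv, hwd, add_zero, map_add,
        LinearMap.mem_ker.1 hy₀, add_zero, h])
    have h2 := green_re u w
    rw [hux, hwv, hwd, inner_zero_left, Complex.zero_re, sub_zero] at h2
    have h3 : (inner ℂ (w : G.HilbertSpace) (G.maxOp u)).re ≤ (n + 1) * ‖G.maxOp u‖ :=
      (Complex.re_le_norm _).trans ((norm_inner_le_norm _ _).trans (by gcongr))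
    have h4 := (Complex.re_le_norm _).trans hwi
    have h5 : C * ‖((u + w : G.maxDomain) : G.HilbertSpace)‖ ^ 2 ≤
        |C| * (‖(u : G.HilbertSpace)‖ + (n + 1)) ^ 2 := by
      refine mul_le_mul (le_abs_self C) ?_ (by positivity) (abs_nonneg C)
      gcongr
      exact (norm_add_le _ _).trans (by gcongr)
    simp only [map_add, Submodule.coe_add, inner_add_left, inner_add_right,
      Complex.add_re] at h1 h5 ⊢
    linarith
  rw [Submodule.mem_orthogonal']
  intro y₀ hy₀
  by_contra hne
  -- this multiple of `y₀` has inner product `-(|k| + 1)` with `x`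
  have h1 := hk ((-((|k| + 1 : ℝ) : ℂ) / inner ℂ x y₀) • y₀) (Submodule.smul_mem _ _ hy₀)
  rw [inner_smul_right, div_mul_cancel₀ _ hne, Complex.neg_re, Complex.ofReal_re] at h1
  linarith [le_abs_self k]

/-- Boundary conditions for which `⟨x, y⟩` is controlled by `‖x‖ ^ 2` give a sectorial operator, by
the trace estimate. -/
theorem isSectorialOp_of_norm_inner_le {c : ℝ} (hc : 0 ≤ c)
    (h : ∀ x y, A x + B y = 0 → ‖(inner ℂ x y : ℂ)‖ ≤ c * ‖x‖ ^ 2) :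
    IsSectorialOp (G.negLaplacian A B) := by
  -- the factor `2` pays for both the imaginary and the real part of `⟨x, y⟩`
  obtain ⟨C, hC⟩ := exists_green (G := G) (c := 2 * c) (by positivity)
  refine ⟨C, (forall_negLaplacian_domain
    (p := fun u v => |(inner ℂ u v).im| ≤ (inner ℂ u v).re + C * ‖u‖ ^ 2)).2 fun u hu => ?_⟩
  obtain ⟨h1, h2⟩ := hC u
  have h3 := h _ _ hu
  have h4 := (Complex.abs_im_le_norm _).trans h3
  have h5 := neg_le_of_abs_le ((Complex.abs_re_le_norm _).trans h3)
  rw [h1]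
  linarith

/-- If `-Δ(A, B)` is quasi-accretive, then `-Δ(A, B) + l` is surjective for large `l = κ²`. The
solutions of `-Δ u + κ² u = 0` form a space of dimension at least `dim 𝒦`, as the Dirichlet problem
is solvable; by accretivity the boundary condition is injective on it, hence surjective, which
allows to correct the boundary values of any solution of the inhomogeneous equation. -/
theorem exists_negLaplacian_add_smul_eq (hq : IsQuasiAccretive (G.negLaplacian A B)) (C : ℝ) :
    ∃ l : ℝ, C < l ∧ ∀ φ, ∃ u : (G.negLaplacian A B).domain,
      G.negLaplacian A B u + (l : ℂ) • (u : G.HilbertSpace) = φ := by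
  obtain ⟨C₀, hC₀⟩ := hq
  -- `l > C` is required, `l > C₀` gives injectivity of `-Δ(A, B) + l`, and `l > 0` is a square
  set l := |C| + |C₀| + 1 with hl
  have hl0 : 0 < l := by positivity
  obtain ⟨κ, hκ, hκl⟩ : ∃ κ : ℝ, 0 < κ ∧ κ ^ 2 = l :=
    ⟨Real.sqrt l, Real.sqrt_pos.2 hl0, Real.sq_sqrt hl0.le⟩
  have hκl' : (κ : ℂ) ^ 2 = (l : ℂ) := by exact_mod_cast hκl
  refine ⟨l, by linarith [le_abs_self C, abs_nonneg C₀], fun φ => ?_⟩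
  let S : G.maxDomain →ₗ[ℂ] G.HilbertSpace := G.maxOp + (l : ℂ) • G.maxDomain.subtype
  have hS : ∀ u, S u = G.maxOp u + (l : ℂ) • (u : G.HilbertSpace) := fun u => rfl
  let Φ : LinearMap.ker S →ₗ[ℂ] BdSpace I E :=
    (A ∘ₗ G.bdValue + B ∘ₗ G.bdDeriv) ∘ₗ (LinearMap.ker S).subtype
  have hΦ : ∀ h, Φ h = A (G.bdValue h) + B (G.bdDeriv h) := fun h => rfl
  have hinj : Function.Injective Φ := by
    rw [← LinearMap.ker_eq_bot, LinearMap.ker_eq_bot']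
    intro h hh
    have h1 : S h = 0 := h.2
    have h2 := norm_le_norm_add_smul_of_accretive hC₀ l
      ⟨h, mem_negLaplacian_domain.2 ⟨h, rfl, hh⟩⟩
    rw [negLaplacian_apply (u := (h : G.maxDomain)) rfl] at h2
    change _ ≤ ‖S h‖ at h2
    rw [h1, norm_zero] at h2
    have h3 : 0 < l - C₀ := by linarith [le_abs_self C₀, abs_nonneg C]
    have h4 : ‖((h : G.maxDomain) : G.HilbertSpace)‖ = 0 := by
      refine le_antisymm ?_ (norm_nonneg _)
      by_contra! hpos
      exact absurd h2 (not_le.2 (mul_pos h3 hpos))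
    exact Subtype.ext (Subtype.ext (norm_eq_zero.1 h4))
  have hfin : FiniteDimensional ℂ (LinearMap.ker S) := FiniteDimensional.of_injective Φ hinj
  have hvs : Function.Surjective (G.bdValue ∘ₗ (LinearMap.ker S).subtype) := by
    intro x
    obtain ⟨u, hu, hu'⟩ := exists_homogeneous (G := G) hκ x
    rw [hκl'] at hu'
    exact ⟨⟨u, hu'⟩, hu⟩
  have hdim : Module.finrank ℂ (LinearMap.ker S) = Module.finrank ℂ (BdSpace I E) :=
    le_antisymm (LinearMap.finrank_le_finrank_of_injective hinj)
      (LinearMap.finrank_le_finrank_of_surjective hvs)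
  have hsurj := (LinearMap.injective_iff_surjective_of_finrank_eq_finrank hdim).1 hinj
  obtain ⟨u₀, hu₀⟩ := exists_maxOp_add_eq (G := G) hκ φ
  rw [hκl'] at hu₀
  obtain ⟨h, hh⟩ := hsurj (-(A (G.bdValue u₀) + B (G.bdDeriv u₀)))
  have hdom : A (G.bdValue (u₀ + h)) + B (G.bdDeriv (u₀ + h)) = 0 := by
    rw [hΦ] at hh
    rw [map_add, map_add, map_add, map_add, add_add_add_comm, hh, add_neg_cancel]
  refine ⟨⟨_, mem_negLaplacian_domain.2 ⟨u₀ + (h : G.maxDomain), rfl, hdom⟩⟩, ?_⟩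
  rw [negLaplacian_apply (u := u₀ + (h : G.maxDomain)) rfl]
  change S (u₀ + (h : G.maxDomain)) = φ
  rw [map_add, LinearMap.mem_ker.1 h.2, add_zero]
  exact hu₀

end MetricGraph

theorem theorem1 {V I E : Type*} [Fintype V] [Fintype I] [Fintype E] (G : MetricGraph V I E)
    (A B : MetricGraph.BdSpace I E →ₗ[ℂ] MetricGraph.BdSpace I E) :
    (IsQuasiMAccretive (G.negLaplacian A B) ↔
      Function.Surjective (LinearMap.coprod A B) ∧
      (LinearMap.range B)ᗮ.starProjection.toLinearMap ∘ₗ A ∘ₗ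
        (LinearMap.id - (LinearMap.ker B).starProjection.toLinearMap) = 0) ∧
    (IsQuasiMAccretive (G.negLaplacian A B) → IsMSectorial (G.negLaplacian A B)) := by
  have hsect : (∀ x y, A x + B y = 0 → x ∈ (LinearMap.ker B)ᗮ) →
      IsSectorialOp (G.negLaplacian A B) := fun h => by
    obtain ⟨c, hc, hb⟩ := exists_norm_inner_le h
    exact MetricGraph.isSectorialOp_of_norm_inner_le hc hb
  refine ⟨⟨fun h => ?_, fun h => ?_⟩, fun h => ⟨?_, h⟩⟩
  · exact surjective_of_forall_mem_ker_orthogonal fun x y hxy =>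
      MetricGraph.mem_ker_orthogonal_of_isQuasiAccretive h.2.1 hxy
  · have hq := (hsect fun x y hxy => mem_ker_orthogonal_of_surjective h.1 h.2 hxy).isQuasiAccretive
    exact hq.isQuasiMAccretive (MetricGraph.exists_negLaplacian_add_smul_eq hq)
  · exact hsect fun x y hxy => MetricGraph.mem_ker_orthogonal_of_isQuasiAccretive h.2.1 hxy
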